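/- **Theorem (HAHP is conservative over HAH).** *Higher-order Heyting arithmetic (HAH).* HAH is the following theory in intuitionistic many-sorted logic with equality. There is a sort for every $n\in\mathbb N$; terms of sort $n$ stand for members of the $n$-th power set of the domain. The function symbols are $0$ (a constant), $\mathsf S$ (unary), $+$ and $\times$ (binary), all with arguments and values of sort $0$. The relation symbols are $=^n$ (between terms of sort $n$) and $\in^n$ (between terms of sort $n$ and $n+1$), for every $n$. Formulas are built with $\bot,\top,\lor,\land,\to$ and $\exists x^n,\forall x^n$. The axioms are, for every $n$ and all formulas $P[z^n]$ and $A[x^0]$, possibly with further free variables ($X$ not free in $P$), $$\forall X^{n+1}\,\forall Y^{n+1}\,(\forall z^n\,(z\in X\leftrightarrow z\in Y)\to X=Y),\qquad \exists X^{n+1}\,\forall z^n\,(z\in X\leftrightarrow P[z]),$$ $$\forall y\,(\mathsf S(y)\neq 0),\qquad \forall x\,\forall y\,(\mathsf S(x)=\mathsf S(y)\to x=y),$$ $$\forall y\,(0+y=y),\quad \forall x\,\forall y\,(\mathsf S(x)+y=\mathsf S(x+y)),\quad \forall y\,(0\times y=0),\quad \forall x\,\forall y\,(\mathsf S(x)\times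 y=(x\times y)+y),$$ $$A[0]\land\forall x\,(A[x]\to A[\mathsf S(x)])\to\forall x\,A[x].$$ *Logic of partial terms.* This logic has in addition an atomic formula $a{\downarrow}$ ("$a$ is defined") for every term $a$. Its rules are those of intuitionistic logic with equality, except that from $\forall x\,B[x]$ and $a{\downarrow}$ one infers $B[a]$, from $B[a]$ and $a{\downarrow}$ one infers $\exists x\,B[x]$, and from $a{\downarrow}$ one infers $a=a$. Moreover $x{\downarrow}$ holds for every variable $x$; from $f(a_1,\dots,a_k){\downarrow}$ one infers $a_i{\downarrow}$ for every function symbol $f$; and from $a=b$ or $a\in b$ one infers $a{\downarrow}$ and $b{\downarrow}$. Write $a\simeq b$ for $a{\downarrow}\lor b{\downarrow}\to a=b$. HAH is regarded as a theory in this logic by adding the axioms that $0$, $\mathsf S$, $+$ and $\times$ are total: $0{\downarrow}$, $\forall x\,\mathsf S(x){\downarrow}$, $\forall x\,\forall y\,(x+y){\downarrow}$, $\forall x\,\forall y\,(x\times y){\downarrow}$. *HAHP.* HAHP is the theory in the logic of partial terms obtained from HAH by adding a partial binary function symbol $\mathsf{app}$ on sort $0$, written $a\,b:=\mathsf{app}(a,b)$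 and associated to the left, and (defined) constants $\mathsf k,\mathsf s,\mathsf{suc},\mathsf{rec}$ of sort $0$, by letting the schemes of comprehension and induction range over all formulas of the larger language, and by adding the axioms $$\forall x\,\forall y\,(\mathsf k\,x\,y=x),\qquad \forall x\,\forall y\,(\mathsf s\,x\,y{\downarrow}),\qquad \forall x\,\forall y\,\forall z\,(\mathsf s\,x\,y\,z\simeq (x\,z)\,(y\,z)),\qquad \forall x\,(\mathsf{suc}\,x=\mathsf S(x)),$$ $$\forall x\,\forall y\,(\mathsf{rec}\,x\,y\,0=x),\qquad \forall x\,\forall y\,\forall z\,(\mathsf{rec}\,x\,y\,(\mathsf S\,z)\simeq y\,z\,(\mathsf{rec}\,x\,y\,z)).$$ *Claim.* HAHP is conservative over HAH: for every formula $A$ (possibly open) in the language of HAH, $\mathrm{HAHP}\vdash A$ if and only if $\mathrm{HAH}\vdash A$. This holds both for HAH as a theory in ordinary intuitionistic higher-order logic, and for HAH as a theory in the logic of partial terms (where $A$ may also contain atomic formulas $a{\downarrow}$). -/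

import Mathlib

/-!
# Higher-order Heyting arithmetic, with and without a primitive partial application

Sorts are the natural numbers: a term of sort `n` stands for a member of the `n`-th power set of
the domain.  Syntax is in de Bruijn style, with a separate supply of variables for every sort: the
quantifiers `all n`, `ex n` bind the variable of sort `n` with index `0`, raise the indices of the
other variables of sort `n` by one, and leave the variables of all other sorts alone.  Formulas
may be open.
-/

namespace HOArith

/-- The three languages.
* `hah`: the language of arithmetic, with formulas of ordinary higher-order logic;
* `hahPartial`: the same symbols, with formulas of the logic of partial terms
  (that is, with the atomic formulas `a ↓`);
* `hahp`: the symbols `app, k, s, suc, rec` are added as well. -/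
inductive Lang
  | hah
  | hahPartial
  | hahp

/-- The underlying logic is the logic of partial terms. -/
def Lang.Partial : Lang → Prop
  | .hah => False
  | .hahPartial => True
  | .hahp => True

/-- The symbols `app, k, s, suc, rec` are available. -/
def Lang.HasApp : Lang → Prop
  | .hah => False
  | .hahPartial => False
  | .hahp => True

/-- Terms, indexed by their sort.  All function symbols take arguments and values of sort `0`. -/
inductive Tm (L : Lang) : ℕ → Type
  /-- the variable of sort `n` with index `i` -/
  | var (n i : ℕ) : Tm L n
  | zero : Tm L 0
  | succ (a : Tm L 0) : Tm L 0
  | add (a b : Tm L 0) : Tm L 0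
  | mul (a b : Tm L 0) : Tm L 0
  /-- the partial binary function symbol `app` -/
  | app (h : L.HasApp) (a b : Tm L 0) : Tm L 0
  /-- the constant `k` -/
  | cK (h : L.HasApp) : Tm L 0
  /-- the constant `s` -/
  | cS (h : L.HasApp) : Tm L 0
  /-- the constant `suc` -/
  | cSuc (h : L.HasApp) : Tm L 0
  /-- the constant `rec` -/
  | cRec (h : L.HasApp) : Tm L 0

/-- Formulas. -/
inductive Fml (L : Lang) : Type
  /-- `a = b`, for terms of the same sort -/
  | eq {n : ℕ} (a b : Tm L n) : Fml L
  /-- `a ∈ b` -/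
  | mem {n : ℕ} (a : Tm L n) (b : Tm L (n + 1)) : Fml L
  /-- `a ↓`, "`a` is defined"; exists only in the logic of partial terms -/
  | den (h : L.Partial) {n : ℕ} (a : Tm L n) : Fml L
  | bot : Fml L
  | top : Fml L
  | or (A B : Fml L) : Fml L
  | and (A B : Fml L) : Fml L
  | imp (A B : Fml L) : Fml L
  | ex (n : ℕ) (B : Fml L) : Fml L
  | all (n : ℕ) (B : Fml L) : Fml L

variable {L : Lang}

/-- Negation. -/
def Fml.neg (A : Fml L) : Fml L := .imp A .bot

/-- Bi-implication. -/
def Fml.iff (A B : Fml L) : Fml L := .and (.imp A B) (.imp B A)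

/-- `a ≃ b`, that is, `a ↓ ∨ b ↓ → a = b`. -/
def Fml.simeq (h : L.Partial) {n : ℕ} (a b : Tm L n) : Fml L :=
  .imp (.or (.den h a) (.den h b)) (.eq a b)

/-! ### Substitution -/

/-- A simultaneous substitution: a term of sort `n` for each variable of sort `n`. -/
abbrev Sub (L : Lang) : Type := (n : ℕ) → ℕ → Tm L n

/-- Simultaneous substitution in a term. -/
def Tm.subst (σ : Sub L) : {n : ℕ} → Tm L n → Tm L n
  | _, .var n i => σ n i
  | _, .zero => .zero
  | _, .succ a => .succ (a.subst σ)
  | _, .add a b => .add (a.subst σ) (b.subst σ)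
  | _, .mul a b => .mul (a.subst σ) (b.subst σ)
  | _, .app h a b => .app h (a.subst σ) (b.subst σ)
  | _, .cK h => .cK h
  | _, .cS h => .cS h
  | _, .cSuc h => .cSuc h
  | _, .cRec h => .cRec h

/-- Raise the indices of the variables of sort `m` by one. -/
def Sub.shift (m : ℕ) : Sub L := fun n i => if n = m then .var n (i + 1) else .var n i

/-- The substitution `σ` under a binder of sort `m`. -/
def Sub.up (m : ℕ) (σ : Sub L) : Sub L := fun n i =>
  if n = m then
    match i with
    | 0 => .var n 0
    | i + 1 => (σ n i).subst (Sub.shift m)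
  else (σ n i).subst (Sub.shift m)

/-- Put `t` for the variable of sort `m` with index `0`, and lower the indices of the other
variables of sort `m` by one. -/
def Sub.inst {m : ℕ} (t : Tm L m) : Sub L := fun n i =>
  if h : n = m then
    match i with
    | 0 => h ▸ t
    | i + 1 => .var n i
  else .var n i

/-- Put `S x` for the variable `x` of sort `0` with index `0`, and keep all other variables. -/
def Sub.succ : Sub L
  | 0, 0 => .succ (.var 0 0)
  | n, i => .var n i

/-- Simultaneous, capture-avoiding substitution in a formula. -/
def Fml.subst : Sub L → Fml L → Fml L
  | σ, .eq a b => .eq (a.subst σ) (b.subst σ)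
  | σ, .mem a b => .mem (a.subst σ) (b.subst σ)
  | σ, .den h a => .den h (a.subst σ)
  | _, .bot => .bot
  | _, .top => .top
  | σ, .or A B => .or (A.subst σ) (B.subst σ)
  | σ, .and A B => .and (A.subst σ) (B.subst σ)
  | σ, .imp A B => .imp (A.subst σ) (B.subst σ)
  | σ, .ex n B => .ex n (B.subst (Sub.up n σ))
  | σ, .all n B => .all n (B.subst (Sub.up n σ))

/-- Weakening by a new variable of sort `m` with index `0`. -/
def Fml.shift (m : ℕ) (A : Fml L) : Fml L := A.subst (Sub.shift m)

/-- `B[t]`, where `B` has been under a binder of sort `m`. -/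
def Fml.inst {m : ℕ} (B : Fml L) (t : Tm L m) : Fml L := B.subst (Sub.inst t)

/-! ### Axioms -/

/-- The non-logical axioms, and the axioms of extensionality and comprehension, of the theory in
the language `L`.  The schemes range over all formulas of the language `L`, with parameters. -/
inductive Ax : (L : Lang) → Fml L → Prop
  /-- `∀ X Y, (∀ z, z ∈ X ↔ z ∈ Y) → X = Y` -/
  | ext {L : Lang} (n : ℕ) : Ax L (.all (n + 1) (.all (n + 1) (.imp
      (.all n (.iff (.mem (.var n 0) (.var (n + 1) 1)) (.mem (.var n 0) (.var (n + 1) 0))))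
      (.eq (.var (n + 1) 1) (.var (n + 1) 0)))))
  /-- `∃ X, ∀ z, z ∈ X ↔ P[z]`, with `X` not free in `P` -/
  | compr {L : Lang} (n : ℕ) (P : Fml L) : Ax L (.ex (n + 1) (.all n
      (.iff (.mem (.var n 0) (.var (n + 1) 0)) (P.shift (n + 1)))))
  /-- `∀ y, S y ≠ 0` -/
  | succ_ne_zero {L : Lang} : Ax L (.all 0 (.neg (.eq (.succ (.var 0 0)) .zero)))
  /-- `∀ x y, S x = S y → x = y` -/
  | succ_inj {L : Lang} : Ax L (.all 0 (.all 0 (.imp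
      (.eq (.succ (.var 0 1)) (.succ (.var 0 0))) (.eq (.var 0 1) (.var 0 0)))))
  /-- `∀ y, 0 + y = y` -/
  | zero_add {L : Lang} : Ax L (.all 0 (.eq (.add .zero (.var 0 0)) (.var 0 0)))
  /-- `∀ x y, S x + y = S (x + y)` -/
  | succ_add {L : Lang} : Ax L (.all 0 (.all 0 (.eq
      (.add (.succ (.var 0 1)) (.var 0 0)) (.succ (.add (.var 0 1) (.var 0 0))))))
  /-- `∀ y, 0 × y = 0` -/
  | zero_mul {L : Lang} : Ax L (.all 0 (.eq (.mul .zero (.var 0 0)) .zero))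
  /-- `∀ x y, S x × y = (x × y) + y` -/
  | succ_mul {L : Lang} : Ax L (.all 0 (.all 0 (.eq
      (.mul (.succ (.var 0 1)) (.var 0 0)) (.add (.mul (.var 0 1) (.var 0 0)) (.var 0 0)))))
  /-- `A[0] ∧ (∀ x, A[x] → A[S x]) → ∀ x, A[x]` -/
  | ind {L : Lang} (A : Fml L) : Ax L (.imp
      (.and (A.inst .zero) (.all 0 (.imp A (A.subst Sub.succ)))) (.all 0 A))
  /-- In the logic of partial terms, every function symbol except `app` is declared total; this is
  the case of `0`. -/
  | zero_den {L : Lang} (h : L.Partial) : Ax L (.den h .zero)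
  | succ_den {L : Lang} (h : L.Partial) : Ax L (.all 0 (.den h (.succ (.var 0 0))))
  | add_den {L : Lang} (h : L.Partial) :
      Ax L (.all 0 (.all 0 (.den h (.add (.var 0 1) (.var 0 0)))))
  | mul_den {L : Lang} (h : L.Partial) :
      Ax L (.all 0 (.all 0 (.den h (.mul (.var 0 1) (.var 0 0)))))
  | k_den {L : Lang} (h : L.Partial) (p : L.HasApp) : Ax L (.den h (.cK p))
  | s_den {L : Lang} (h : L.Partial) (p : L.HasApp) : Ax L (.den h (.cS p))
  | suc_den {L : Lang} (h : L.Partial) (p : L.HasApp) : Ax L (.den h (.cSuc p))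
  | rec_den {L : Lang} (h : L.Partial) (p : L.HasApp) : Ax L (.den h (.cRec p))
  /-- `∀ x y, k x y = x` -/
  | k_app {L : Lang} (p : L.HasApp) : Ax L (.all 0 (.all 0 (.eq
      (.app p (.app p (.cK p) (.var 0 1)) (.var 0 0)) (.var 0 1))))
  /-- `∀ x y, s x y ↓` -/
  | s_app_den {L : Lang} (h : L.Partial) (p : L.HasApp) : Ax L (.all 0 (.all 0 (.den h
      (.app p (.app p (.cS p) (.var 0 1)) (.var 0 0)))))
  /-- `∀ x y z, s x y z ≃ (x z) (y z)` -/
  | s_app {L : Lang} (h : L.Partial) (p : L.HasApp) : Ax L (.all 0 (.all 0 (.all 0 (.simeq h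
      (.app p (.app p (.app p (.cS p) (.var 0 2)) (.var 0 1)) (.var 0 0))
      (.app p (.app p (.var 0 2) (.var 0 0)) (.app p (.var 0 1) (.var 0 0)))))))
  /-- `∀ x, suc x = S x` -/
  | suc_app {L : Lang} (p : L.HasApp) : Ax L (.all 0 (.eq
      (.app p (.cSuc p) (.var 0 0)) (.succ (.var 0 0))))
  /-- `∀ x y, rec x y 0 = x` -/
  | rec_zero {L : Lang} (p : L.HasApp) : Ax L (.all 0 (.all 0 (.eq
      (.app p (.app p (.app p (.cRec p) (.var 0 1)) (.var 0 0)) .zero) (.var 0 1))))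
  /-- `∀ x y z, rec x y (S z) ≃ y z (rec x y z)` -/
  | rec_succ {L : Lang} (h : L.Partial) (p : L.HasApp) :
      Ax L (.all 0 (.all 0 (.all 0 (.simeq h
        (.app p (.app p (.app p (.cRec p) (.var 0 2)) (.var 0 1)) (.succ (.var 0 0)))
        (.app p (.app p (.var 0 1) (.var 0 0))
          (.app p (.app p (.app p (.cRec p) (.var 0 2)) (.var 0 1)) (.var 0 0)))))))

/-! ### Derivations -/

/-- Intuitionistic natural deduction, from the axioms `Ax L`: `Der Γ A` says that `A` is derivable
from the hypotheses `Γ`.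

If `L` is not partial, the premises of the form `∀ h : L.Partial, _` are void and the rules
`den_*` do not apply; what remains is ordinary intuitionistic logic with equality.  If `L` is
partial, the calculus is the logic of partial terms: `all_elim`, `ex_intro` and reflexivity of
equality require that the term is defined, and functions and relations are strict. -/
inductive Der {L : Lang} : List (Fml L) → Fml L → Prop
  | ax {Γ : List (Fml L)} {A : Fml L} : Ax L A → Der Γ A
  | hyp {Γ : List (Fml L)} {A : Fml L} : A ∈ Γ → Der Γ A
  | top_intro {Γ : List (Fml L)} : Der Γ .top
  | bot_elim {Γ : List (Fml L)} {A : Fml L} : Der Γ .bot → Der Γ A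
  | and_intro {Γ : List (Fml L)} {A B : Fml L} : Der Γ A → Der Γ B → Der Γ (.and A B)
  | and_left {Γ : List (Fml L)} {A B : Fml L} : Der Γ (.and A B) → Der Γ A
  | and_right {Γ : List (Fml L)} {A B : Fml L} : Der Γ (.and A B) → Der Γ B
  | or_left {Γ : List (Fml L)} {A B : Fml L} : Der Γ A → Der Γ (.or A B)
  | or_right {Γ : List (Fml L)} {A B : Fml L} : Der Γ B → Der Γ (.or A B)
  | or_elim {Γ : List (Fml L)} {A B C : Fml L} :
      Der Γ (.or A B) → Der (A :: Γ) C → Der (B :: Γ) C → Der Γ C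
  | imp_intro {Γ : List (Fml L)} {A B : Fml L} : Der (A :: Γ) B → Der Γ (.imp A B)
  | imp_elim {Γ : List (Fml L)} {A B : Fml L} : Der Γ (.imp A B) → Der Γ A → Der Γ B
  | all_intro {Γ : List (Fml L)} {n : ℕ} {B : Fml L} :
      Der (Γ.map (Fml.shift n)) B → Der Γ (.all n B)
  | all_elim {Γ : List (Fml L)} {n : ℕ} {B : Fml L} (a : Tm L n) :
      Der Γ (.all n B) → (∀ h : L.Partial, Der Γ (.den h a)) → Der Γ (B.inst a)
  | ex_intro {Γ : List (Fml L)} {n : ℕ} {B : Fml L} (a : Tm L n) :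
      Der Γ (B.inst a) → (∀ h : L.Partial, Der Γ (.den h a)) → Der Γ (.ex n B)
  | ex_elim {Γ : List (Fml L)} {n : ℕ} {B C : Fml L} :
      Der Γ (.ex n B) → Der (B :: Γ.map (Fml.shift n)) (C.shift n) → Der Γ C
  | eq_refl {Γ : List (Fml L)} {n : ℕ} (a : Tm L n) :
      (∀ h : L.Partial, Der Γ (.den h a)) → Der Γ (.eq a a)
  | eq_subst {Γ : List (Fml L)} {n : ℕ} {a b : Tm L n} (B : Fml L) :
      Der Γ (.eq a b) → Der Γ (B.inst a) → Der Γ (B.inst b)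
  | den_var {Γ : List (Fml L)} (h : L.Partial) (n i : ℕ) : Der Γ (.den h (.var n i))
  | den_succ {Γ : List (Fml L)} (h : L.Partial) {a : Tm L 0} :
      Der Γ (.den h (.succ a)) → Der Γ (.den h a)
  | den_add_left {Γ : List (Fml L)} (h : L.Partial) {a b : Tm L 0} :
      Der Γ (.den h (.add a b)) → Der Γ (.den h a)
  | den_add_right {Γ : List (Fml L)} (h : L.Partial) {a b : Tm L 0} :
      Der Γ (.den h (.add a b)) → Der Γ (.den h b)
  | den_mul_left {Γ : List (Fml L)} (h : L.Partial) {a b : Tm L 0} :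
      Der Γ (.den h (.mul a b)) → Der Γ (.den h a)
  | den_mul_right {Γ : List (Fml L)} (h : L.Partial) {a b : Tm L 0} :
      Der Γ (.den h (.mul a b)) → Der Γ (.den h b)
  | den_app_left {Γ : List (Fml L)} (h : L.Partial) (p : L.HasApp) {a b : Tm L 0} :
      Der Γ (.den h (.app p a b)) → Der Γ (.den h a)
  | den_app_right {Γ : List (Fml L)} (h : L.Partial) (p : L.HasApp) {a b : Tm L 0} :
      Der Γ (.den h (.app p a b)) → Der Γ (.den h b)
  | den_eq_left {Γ : List (Fml L)} (h : L.Partial) {n : ℕ} {a b : Tm L n} :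
      Der Γ (.eq a b) → Der Γ (.den h a)
  | den_eq_right {Γ : List (Fml L)} (h : L.Partial) {n : ℕ} {a b : Tm L n} :
      Der Γ (.eq a b) → Der Γ (.den h b)
  | den_mem_left {Γ : List (Fml L)} (h : L.Partial) {n : ℕ} {a : Tm L n} {b : Tm L (n + 1)} :
      Der Γ (.mem a b) → Der Γ (.den h a)
  | den_mem_right {Γ : List (Fml L)} (h : L.Partial) {n : ℕ} {a : Tm L n} {b : Tm L (n + 1)} :
      Der Γ (.mem a b) → Der Γ (.den h b)

/-- The theory in the language `L` proves the formula `A`.  For `hah` this is provability in HAH,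
for `hahPartial` provability in HAH as a theory in the logic of partial terms, and for `hahp`
provability in HAHP. -/
def Provable {L : Lang} (A : Fml L) : Prop := Der [] A

/-! ### Inclusions of languages -/

/-- A term of a language as a term of a larger language. -/
def Tm.incl {L' : Lang} (i : L.HasApp → L'.HasApp) : {n : ℕ} → Tm L n → Tm L' n
  | _, .var n j => .var n j
  | _, .zero => .zero
  | _, .succ a => .succ (a.incl i)
  | _, .add a b => .add (a.incl i) (b.incl i)
  | _, .mul a b => .mul (a.incl i) (b.incl i)
  | _, .app h a b => .app (i h) (a.incl i) (b.incl i)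
  | _, .cK h => .cK (i h)
  | _, .cS h => .cS (i h)
  | _, .cSuc h => .cSuc (i h)
  | _, .cRec h => .cRec (i h)

/-- A formula of a language as a formula of a larger language. -/
def Fml.incl {L' : Lang} (i : L.HasApp → L'.HasApp) (j : L.Partial → L'.Partial) :
    Fml L → Fml L'
  | .eq a b => .eq (a.incl i) (b.incl i)
  | .mem a b => .mem (a.incl i) (b.incl i)
  | .den h a => .den (j h) (a.incl i)
  | .bot => .bot
  | .top => .top
  | .or A B => .or (A.incl i j) (B.incl i j)
  | .and A B => .and (A.incl i j) (B.incl i j)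
  | .imp A B => .imp (A.incl i j) (B.incl i j)
  | .ex n B => .ex n (B.incl i j)
  | .all n B => .all n (B.incl i j)

/-- A formula of any of the three languages as a formula of HAHP: the same symbols, read in the
largest language. -/
def Fml.toHAHP (A : Fml L) : Fml .hahp := A.incl (fun _ => trivial) (fun _ => trivial)

end HOArith

/-! HAH embeds into HAHP because terms without `app` are provably defined there. For the converse,
HAHP is interpreted in HAH with the same numbers and sets. A combinator with at most two arguments
is coded by a number. The graph `App` of application is the least ternary relation closed under the
clauses for `k`, `s`, `suc` and `rec`; impredicative quantification over sets makes it definable.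
Induction over `App`, together with injectivity of the coding, shows that each clause can be
inverted (`app_inv`) and that the graph is single-valued (`app_functional`), so that the axioms of
HAHP hold.

The interpretation takes its values in `Om L`, a complete Heyting algebra of properties of contexts,
not in formulas. Derivability `ofFml` maps formulas into it and preserves all connectives, and also
the quantifiers, which become quantifiers over all open terms (`ofFml_all`, `ofFml_ex`). Reasoning
inside HAH can thus use the binders of the metatheory. The price is that induction, comprehension
and Leibniz's rule are available only for truth values that come from a formula; the predicates `D`,
`DT`, `DS` and `DR` keep track of this.

A term of HAHP is interpreted by its graph `val`, so an undefined term is one without a value.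
Soundness is `sem_of_der`. By `sem_toHAHP` the truth value of a formula without `app` is its
derivability in HAH, and evaluating in the empty context at the identity valuation gives
conservativity. -/

namespace HOArith

variable {L : Lang}

/-! ### The calculus of substitutions -/

/-- The identity substitution. -/
def Sub.vars : Sub L := fun n i => .var n i

/-- First `σ`, then `τ`. -/
def Sub.comp (σ τ : Sub L) : Sub L := fun n i => (σ n i).subst τ

/-- Put `t` for the variable of sort `m` with index `0`, and use `ρ` for the other variables, after
lowering the indices of those of sort `m` by one. -/
def Sub.cons {m : ℕ} (t : Tm L m) (ρ : Sub L) : Sub L := fun n i =>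
  if h : n = m then
    match i with
    | 0 => h ▸ t
    | i + 1 => ρ n i
  else ρ n i

/-- Forget the value of the variable of sort `m` with index `0`. -/
def Sub.tail (m : ℕ) (ρ : Sub L) : Sub L := Sub.comp (Sub.shift m) ρ

@[simp] theorem Sub.cons_zero {m : ℕ} (t : Tm L m) (ρ : Sub L) : Sub.cons t ρ m 0 = t := by
  simp [Sub.cons]

@[simp] theorem Sub.cons_succ {m : ℕ} (t : Tm L m) (ρ : Sub L) (i : ℕ) :
    Sub.cons t ρ m (i + 1) = ρ m i := by
  simp [Sub.cons]

theorem Sub.cons_of_ne {m n : ℕ} (h : n ≠ m) (t : Tm L m) (ρ : Sub L) (i : ℕ) :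
    Sub.cons t ρ n i = ρ n i := by
  simp [Sub.cons, h]

@[simp] theorem Sub.tail_self (m i : ℕ) (ρ : Sub L) : Sub.tail m ρ m i = ρ m (i + 1) := by
  simp [Sub.tail, Sub.comp, Sub.shift, Tm.subst]

theorem Sub.tail_of_ne {m n : ℕ} (h : n ≠ m) (i : ℕ) (ρ : Sub L) :
    Sub.tail m ρ n i = ρ n i := by
  simp [Sub.tail, Sub.comp, Sub.shift, Tm.subst, h]

theorem Sub.ext_sort {σ τ : Sub L} (m : ℕ) (h₀ : σ m 0 = τ m 0)
    (h₁ : ∀ i, σ m (i + 1) = τ m (i + 1)) (h₂ : ∀ n, n ≠ m → ∀ i, σ n i = τ n i) : σ = τ := by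
  funext n i
  by_cases h : n = m
  · subst h
    cases i with
    | zero => exact h₀
    | succ i => exact h₁ i
  · exact h₂ n h i

@[simp] theorem Sub.tail_cons {m : ℕ} (t : Tm L m) (ρ : Sub L) :
    Sub.tail m (Sub.cons t ρ) = ρ := by
  funext n i
  by_cases h : n = m
  · subst h; simp
  · simp [Sub.tail_of_ne h, Sub.cons_of_ne h]

theorem Sub.inst_eq_cons {m : ℕ} (t : Tm L m) : Sub.inst t = Sub.cons t Sub.vars := rfl

theorem Tm.subst_vars {n : ℕ} (t : Tm L n) : t.subst Sub.vars = t := by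
  induction t <;> simp_all [Tm.subst, Sub.vars]

theorem Tm.subst_subst {n : ℕ} (t : Tm L n) (σ τ : Sub L) :
    (t.subst σ).subst τ = t.subst (Sub.comp σ τ) := by
  induction t <;> simp_all [Tm.subst, Sub.comp]

@[simp] theorem Sub.up_zero (m : ℕ) (σ : Sub L) : Sub.up m σ m 0 = .var m 0 := by
  simp [Sub.up]

@[simp] theorem Sub.up_succ (m i : ℕ) (σ : Sub L) :
    Sub.up m σ m (i + 1) = (σ m i).subst (Sub.shift m) := by
  simp [Sub.up]

theorem Sub.up_of_ne {m n : ℕ} (h : n ≠ m) (i : ℕ) (σ : Sub L) :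
    Sub.up m σ n i = (σ n i).subst (Sub.shift m) := by
  simp [Sub.up, h]

theorem Sub.comp_assoc (σ τ υ : Sub L) :
    Sub.comp (Sub.comp σ τ) υ = Sub.comp σ (Sub.comp τ υ) := by
  funext n i
  exact Tm.subst_subst _ _ _

theorem Sub.comp_vars (σ : Sub L) : Sub.comp σ Sub.vars = σ := by
  funext n i
  exact Tm.subst_vars _

/-- With the lift under a binder written as an extension, the remaining laws follow from
`cons_comp`, `shift_comp_cons` and associativity, with no further case distinction on indices. -/
theorem Sub.up_eq_cons (m : ℕ) (σ : Sub L) :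
    Sub.up m σ = Sub.cons (.var m 0) (Sub.comp σ (Sub.shift m)) := by
  refine Sub.ext_sort m (by simp) (fun i => by simp [Sub.comp]) fun n h i => ?_
  rw [Sub.up_of_ne h, Sub.cons_of_ne h, Sub.comp]

theorem Sub.cons_comp {m : ℕ} (t : Tm L m) (ρ σ : Sub L) :
    Sub.comp (Sub.cons t ρ) σ = Sub.cons (t.subst σ) (Sub.comp ρ σ) := by
  refine Sub.ext_sort m (by simp [Sub.comp]) (fun i => by simp [Sub.comp]) fun n h i => ?_
  simp [Sub.comp, Sub.cons_of_ne h]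

theorem Sub.shift_comp_cons {m : ℕ} (t : Tm L m) (ρ : Sub L) :
    Sub.comp (Sub.shift m) (Sub.cons t ρ) = ρ :=
  Sub.tail_cons t ρ

theorem Sub.up_comp_cons {m : ℕ} (t : Tm L m) (σ ρ : Sub L) :
    Sub.comp (Sub.up m σ) (Sub.cons t ρ) = Sub.cons t (Sub.comp σ ρ) := by
  rw [Sub.up_eq_cons, Sub.cons_comp, Sub.comp_assoc, Sub.shift_comp_cons]
  simp [Tm.subst]

theorem Sub.shift_comp_up (m : ℕ) (σ : Sub L) :
    Sub.comp (Sub.shift m) (Sub.up m σ) = Sub.comp σ (Sub.shift m) := by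
  rw [Sub.up_eq_cons, Sub.shift_comp_cons]

theorem Sub.up_comp_up (m : ℕ) (σ τ : Sub L) :
    Sub.comp (Sub.up m σ) (Sub.up m τ) = Sub.up m (Sub.comp σ τ) := by
  rw [Sub.up_eq_cons m τ, Sub.up_comp_cons, Sub.up_eq_cons, Sub.comp_assoc]

theorem Sub.up_vars (m : ℕ) : Sub.up m (Sub.vars : Sub L) = Sub.vars := by
  refine Sub.ext_sort m (by simp [Sub.vars]) (fun i => by simp [Sub.vars, Tm.subst, Sub.shift])
    fun n h i => ?_
  simp [Sub.up_of_ne h, Sub.vars, Tm.subst, Sub.shift, h]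

theorem Fml.subst_vars (A : Fml L) : A.subst Sub.vars = A := by
  induction A <;> simp_all [Fml.subst, Tm.subst_vars, Sub.up_vars]

theorem Fml.subst_subst (A : Fml L) (σ τ : Sub L) :
    (A.subst σ).subst τ = A.subst (Sub.comp σ τ) := by
  induction A generalizing σ τ <;> simp_all [Fml.subst, Tm.subst_subst, Sub.up_comp_up]

theorem Fml.subst_up_inst {m : ℕ} (B : Fml L) (σ : Sub L) (t : Tm L m) :
    (B.subst (Sub.up m σ)).inst t = B.subst (Sub.cons t σ) := by
  rw [Fml.inst, Fml.subst_subst, Sub.inst_eq_cons, Sub.up_comp_cons, Sub.comp_vars]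

theorem Fml.inst_subst {m : ℕ} (B : Fml L) (σ : Sub L) (t : Tm L m) :
    (B.inst t).subst σ = (B.subst (Sub.up m σ)).inst (t.subst σ) := by
  rw [Fml.subst_up_inst, Fml.inst, Fml.subst_subst, Sub.inst_eq_cons, Sub.cons_comp]
  rfl

theorem Fml.shift_subst_up (m : ℕ) (A : Fml L) (σ : Sub L) :
    (A.shift m).subst (Sub.up m σ) = (A.subst σ).shift m := by
  rw [Fml.shift, Fml.shift, Fml.subst_subst, Fml.subst_subst, Sub.shift_comp_up]

theorem Sub.succ_eq_cons :
    (Sub.succ : Sub L) = Sub.cons (.succ (.var 0 0)) (Sub.comp Sub.vars (Sub.shift 0)) := by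
  refine Sub.ext_sort 0 rfl (fun i => rfl) fun n h i => ?_
  rw [Sub.cons_of_ne h]
  cases n with
  | zero => exact absurd rfl h
  | succ n => rfl

theorem Fml.subst_succ_subst_up (A : Fml L) (σ : Sub L) :
    (A.subst Sub.succ).subst (Sub.up 0 σ) = (A.subst (Sub.up 0 σ)).subst Sub.succ := by
  rw [Fml.subst_subst, Fml.subst_subst, Sub.succ_eq_cons, Sub.up_comp_cons, Sub.cons_comp,
    Sub.comp_assoc, Sub.shift_comp_up]
  simp [Tm.subst]
  rfl

theorem Sub.shift_comp_shift (m n : ℕ) :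
    Sub.comp (Sub.shift m) (Sub.shift n) = Sub.comp (Sub.shift n) (Sub.shift m : Sub L) := by
  funext l j
  simp only [Sub.comp, Sub.shift]
  split_ifs <;> simp_all [Tm.subst, Sub.shift]

theorem Sub.tail_cons_of_ne {m n : ℕ} (h : n ≠ m) (t : Tm L n) (ρ : Sub L) :
    Sub.tail m (Sub.cons t ρ) = Sub.cons t (Sub.tail m ρ) := by
  refine Sub.ext_sort n (by simp [Sub.tail_of_ne h]) (fun i => by simp [Sub.tail_of_ne h])
    fun k hk i => ?_
  rw [Sub.cons_of_ne hk]
  by_cases hm : k = m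
  · subst hm
    rw [Sub.tail_self, Sub.cons_of_ne hk, Sub.tail_self]
  · rw [Sub.tail_of_ne hm, Sub.cons_of_ne hk, Sub.tail_of_ne hm]

/-- Serves the comprehension axiom, where `P` is weakened by the set variable of the outer binder
while sitting under an inner binder of another sort. -/
theorem Sub.shift_comp_up_up {m n : ℕ} (h : n ≠ m) (σ : Sub L) :
    Sub.comp (Sub.shift m) (Sub.up n (Sub.up m σ)) =
      Sub.comp (Sub.up n σ) (Sub.shift m) := by
  rw [Sub.up_eq_cons n, Sub.up_eq_cons n, Sub.cons_comp, ← Sub.tail, Sub.tail_cons_of_ne h,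
    Sub.tail, ← Sub.comp_assoc, Sub.shift_comp_up, Sub.comp_assoc, Sub.comp_assoc,
    Sub.shift_comp_shift]
  simp [Tm.subst, Sub.shift, h]

theorem Ax.subst {A : Fml L} (h : Ax L A) (σ : Sub L) : Ax L (A.subst σ) := by
  cases h with
  | ext n =>
    convert Ax.ext n using 1
    simp [Fml.subst, Tm.subst, Sub.up, Fml.iff, Sub.shift]
  | compr n P =>
    convert Ax.compr n (P.subst (Sub.up n σ)) using 1
    simp [Fml.subst, Tm.subst, Sub.up_of_ne, Fml.iff, Sub.shift, Fml.shift, Fml.subst_subst,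
      Sub.shift_comp_up_up]
  | ind A =>
    convert Ax.ind (A.subst (Sub.up 0 σ)) using 1
    simp [Fml.subst, Fml.inst_subst, Fml.subst_succ_subst_up, Tm.subst]
  | succ_ne_zero => exact Ax.succ_ne_zero
  | succ_inj => exact Ax.succ_inj
  | zero_add => exact Ax.zero_add
  | succ_add => exact Ax.succ_add
  | zero_mul => exact Ax.zero_mul
  | succ_mul => exact Ax.succ_mul
  | zero_den h => exact Ax.zero_den h
  | succ_den h => exact Ax.succ_den h
  | add_den h => exact Ax.add_den h
  | mul_den h => exact Ax.mul_den h
  | k_den h p => exact Ax.k_den h p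
  | s_den h p => exact Ax.s_den h p
  | suc_den h p => exact Ax.suc_den h p
  | rec_den h p => exact Ax.rec_den h p
  | k_app p => exact Ax.k_app p
  | s_app_den h p => exact Ax.s_app_den h p
  | s_app h p => exact Ax.s_app h p
  | suc_app p => exact Ax.suc_app p
  | rec_zero p => exact Ax.rec_zero p
  | rec_succ h p => exact Ax.rec_succ h p

/-! ### Structural properties of derivations -/

theorem Der.weaken {Γ : List (Fml L)} {A : Fml L} (d : Der Γ A) :
    ∀ {Δ : List (Fml L)}, Γ ⊆ Δ → Der Δ A := by
  induction d with
  | ax h => exact fun _ => .ax h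
  | hyp h => exact fun s => .hyp (s h)
  | top_intro => exact fun _ => .top_intro
  | bot_elim _ ih => exact fun s => .bot_elim (ih s)
  | and_intro _ _ ih₁ ih₂ => exact fun s => .and_intro (ih₁ s) (ih₂ s)
  | and_left _ ih => exact fun s => .and_left (ih s)
  | and_right _ ih => exact fun s => .and_right (ih s)
  | or_left _ ih => exact fun s => .or_left (ih s)
  | or_right _ ih => exact fun s => .or_right (ih s)
  | or_elim _ _ _ ih₁ ih₂ ih₃ =>
    exact fun s => .or_elim (ih₁ s) (ih₂ (List.cons_subset_cons _ s))
      (ih₃ (List.cons_subset_cons _ s))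
  | imp_intro _ ih => exact fun s => .imp_intro (ih (List.cons_subset_cons _ s))
  | imp_elim _ _ ih₁ ih₂ => exact fun s => .imp_elim (ih₁ s) (ih₂ s)
  | all_intro _ ih => exact fun s => .all_intro (ih (List.map_subset _ s))
  | all_elim a _ _ ih₁ ih₂ => exact fun s => .all_elim a (ih₁ s) fun h => ih₂ h s
  | ex_intro a _ _ ih₁ ih₂ => exact fun s => .ex_intro a (ih₁ s) fun h => ih₂ h s
  | ex_elim _ _ ih₁ ih₂ =>
    exact fun s => .ex_elim (ih₁ s) (ih₂ (List.cons_subset_cons _ (List.map_subset _ s)))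
  | eq_refl a _ ih => exact fun s => .eq_refl a fun h => ih h s
  | eq_subst B _ _ ih₁ ih₂ => exact fun s => .eq_subst B (ih₁ s) (ih₂ s)
  | den_var h n i => exact fun _ => .den_var h n i
  | den_succ h _ ih => exact fun s => .den_succ h (ih s)
  | den_add_left h _ ih => exact fun s => .den_add_left h (ih s)
  | den_add_right h _ ih => exact fun s => .den_add_right h (ih s)
  | den_mul_left h _ ih => exact fun s => .den_mul_left h (ih s)
  | den_mul_right h _ ih => exact fun s => .den_mul_right h (ih s)
  | den_app_left h p _ ih => exact fun s => .den_app_left h p (ih s)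
  | den_app_right h p _ ih => exact fun s => .den_app_right h p (ih s)
  | den_eq_left h _ ih => exact fun s => .den_eq_left h (ih s)
  | den_eq_right h _ ih => exact fun s => .den_eq_right h (ih s)
  | den_mem_left h _ ih => exact fun s => .den_mem_left h (ih s)
  | den_mem_right h _ ih => exact fun s => .den_mem_right h (ih s)

/-- A language without `app`; every term of such a language is defined. -/
class NoApp (L : Lang) : Prop where
  not_hasApp : ¬ L.HasApp

instance : NoApp .hah := ⟨fun h => h⟩

instance : NoApp .hahPartial := ⟨fun h => h⟩

theorem Der.all_elim' {Γ : List (Fml L)} {n : ℕ} {B C : Fml L} (a : Tm L n)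
    (d : Der Γ (.all n B)) (h : ∀ h : L.Partial, Der Γ (.den h a)) (e : B.inst a = C) :
    Der Γ C :=
  e ▸ Der.all_elim a d h

theorem Der.den_succ_intro {Γ : List (Fml L)} (h : L.Partial) {a : Tm L 0}
    (d : Der Γ (.den h a)) : Der Γ (.den h (.succ a)) :=
  .all_elim' a (.ax (.succ_den h)) (fun _ => d) rfl

theorem Der.den_add_intro {Γ : List (Fml L)} (h : L.Partial) {a b : Tm L 0}
    (d : Der Γ (.den h a)) (e : Der Γ (.den h b)) : Der Γ (.den h (.add a b)) := by
  refine .all_elim' b (.all_elim' a (.ax (.add_den h)) (fun _ => d) rfl) (fun _ => e) ?_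
  simp [Fml.inst, Fml.subst, Tm.subst, Sub.inst_eq_cons, Tm.subst_subst,
    Sub.shift_comp_cons, Tm.subst_vars]

theorem Der.den_mul_intro {Γ : List (Fml L)} (h : L.Partial) {a b : Tm L 0}
    (d : Der Γ (.den h a)) (e : Der Γ (.den h b)) : Der Γ (.den h (.mul a b)) := by
  refine .all_elim' b (.all_elim' a (.ax (.mul_den h)) (fun _ => d) rfl) (fun _ => e) ?_
  simp [Fml.inst, Fml.subst, Tm.subst, Sub.inst_eq_cons, Tm.subst_subst,
    Sub.shift_comp_cons, Tm.subst_vars]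

theorem Der.den_all [NoApp L] (Γ : List (Fml L)) (h : L.Partial) {n : ℕ} (a : Tm L n) :
    Der Γ (.den h a) := by
  induction a with
  | var n i => exact .den_var h n i
  | zero => exact .ax (.zero_den h)
  | succ a ih => exact .den_succ_intro h ih
  | add a b ih₁ ih₂ => exact .den_add_intro h ih₁ ih₂
  | mul a b ih₁ ih₂ => exact .den_mul_intro h ih₁ ih₂
  | app p | cK p | cS p | cSuc p | cRec p => exact absurd p NoApp.not_hasApp

/-- Substitution turns `den_var` into definedness of an arbitrary term; this is where totality of
all function symbols (`den_all`) enters. -/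
theorem Der.subst [NoApp L] {Γ : List (Fml L)} {A : Fml L} (d : Der Γ A) :
    ∀ σ : Sub L, Der (Γ.map (Fml.subst σ)) (A.subst σ) := by
  have key : ∀ (Γ : List (Fml L)) (n : ℕ) (σ : Sub L),
      (Γ.map (Fml.shift n)).map (Fml.subst (Sub.up n σ)) =
        (Γ.map (Fml.subst σ)).map (Fml.shift n) := fun Γ n σ => by
    simp [Fml.shift_subst_up]
  induction d with
  | ax h => exact fun σ => .ax (h.subst σ)
  | hyp h => exact fun σ => .hyp (List.mem_map_of_mem h)
  | top_intro => exact fun _ => .top_intro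
  | bot_elim _ ih => exact fun s => .bot_elim (ih s)
  | and_intro _ _ ih₁ ih₂ => exact fun s => .and_intro (ih₁ s) (ih₂ s)
  | and_left _ ih => exact fun s => .and_left (ih s)
  | and_right _ ih => exact fun s => .and_right (ih s)
  | or_left _ ih => exact fun s => .or_left (ih s)
  | or_right _ ih => exact fun s => .or_right (ih s)
  | or_elim _ _ _ ih₁ ih₂ ih₃ => exact fun s => .or_elim (ih₁ s) (ih₂ s) (ih₃ s)
  | imp_intro _ ih => exact fun s => .imp_intro (ih s)
  | imp_elim _ _ ih₁ ih₂ => exact fun s => .imp_elim (ih₁ s) (ih₂ s)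
  | all_intro _ ih => exact fun s => .all_intro (key _ _ s ▸ ih (Sub.up _ s))
  | all_elim a _ _ ih₁ ih₂ =>
    exact fun s => Fml.inst_subst _ s a ▸ .all_elim _ (ih₁ s) fun h => ih₂ h s
  | ex_intro a _ _ ih₁ ih₂ =>
    exact fun s => .ex_intro _ (Fml.inst_subst _ s a ▸ ih₁ s) fun h => ih₂ h s
  | ex_elim _ _ ih₁ ih₂ =>
    exact fun s => .ex_elim (ih₁ s) (key _ _ s ▸ Fml.shift_subst_up _ _ s ▸ ih₂ (Sub.up _ s))
  | eq_refl a _ ih => exact fun s => .eq_refl _ fun h => ih h s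
  | @eq_subst _ _ a b B _ _ ih₁ ih₂ =>
    exact fun s => Fml.inst_subst _ s b ▸
      .eq_subst _ (ih₁ s) (Fml.inst_subst _ s a ▸ ih₂ s)
  | den_var h n i => exact fun _ => .den_all _ h _
  | den_succ h | den_add_left h | den_add_right h | den_mul_left h | den_mul_right h
  | den_app_left h | den_app_right h | den_eq_left h | den_eq_right h | den_mem_left h
  | den_mem_right h => exact fun _ => .den_all _ h _

/-! ### Fresh variables -/

/-- Freshness is expressed by its effect: only the values of a substitution at indices below `N`, in
whatever sort, can matter. -/
theorem Tm.exists_fresh {n : ℕ} (a : Tm L n) :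
    ∃ N, ∀ σ τ : Sub L, (∀ n i, i < N → σ n i = τ n i) → a.subst σ = a.subst τ := by
  induction a with
  | var n i => exact ⟨i + 1, fun σ τ h => h n i (Nat.lt_succ_self i)⟩
  | zero | cK | cS | cSuc | cRec => exact ⟨0, fun _ _ _ => rfl⟩
  | succ a ih =>
    obtain ⟨N, hN⟩ := ih
    exact ⟨N, fun σ τ h => by simp only [Tm.subst, hN σ τ h]⟩
  | add a b ih₁ ih₂ | mul a b ih₁ ih₂ | app _ a b ih₁ ih₂ =>
    obtain ⟨N, hN⟩ := ih₁
    obtain ⟨M, hM⟩ := ih₂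
    refine ⟨max N M, fun σ τ h => ?_⟩
    simp only [Tm.subst, hN σ τ fun n i hi => h n i (lt_max_of_lt_left hi),
      hM σ τ fun n i hi => h n i (lt_max_of_lt_right hi)]

/-- The lifted substitution reads an index no larger than the given one, so a bound for the body of
a quantifier also serves the quantified formula. -/
theorem Sub.up_congr {σ τ : Sub L} {N : ℕ} (m : ℕ) (h : ∀ n i, i < N → σ n i = τ n i) :
    ∀ n i, i < N → Sub.up m σ n i = Sub.up m τ n i := by
  intro n i hi
  by_cases hn : n = m
  · subst hn
    cases i with
    | zero => simp
    | succ i => simp [h n i (Nat.lt_of_succ_lt hi)]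
  · simp [Sub.up_of_ne hn, h n i hi]

theorem Fml.exists_fresh (A : Fml L) :
    ∃ N, ∀ σ τ : Sub L, (∀ n i, i < N → σ n i = τ n i) → A.subst σ = A.subst τ := by
  induction A with
  | eq a b | mem a b =>
    obtain ⟨N, hN⟩ := a.exists_fresh
    obtain ⟨M, hM⟩ := b.exists_fresh
    refine ⟨max N M, fun σ τ h => ?_⟩
    simp only [Fml.subst, hN σ τ fun n i hi => h n i (lt_max_of_lt_left hi),
      hM σ τ fun n i hi => h n i (lt_max_of_lt_right hi)]
  | den _ a =>
    obtain ⟨N, hN⟩ := a.exists_fresh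
    exact ⟨N, fun σ τ h => by simp only [Fml.subst, hN σ τ h]⟩
  | bot | top => exact ⟨0, fun _ _ _ => rfl⟩
  | or A B ih₁ ih₂ | and A B ih₁ ih₂ | imp A B ih₁ ih₂ =>
    obtain ⟨N, hN⟩ := ih₁
    obtain ⟨M, hM⟩ := ih₂
    refine ⟨max N M, fun σ τ h => ?_⟩
    simp only [Fml.subst, hN σ τ fun n i hi => h n i (lt_max_of_lt_left hi),
      hM σ τ fun n i hi => h n i (lt_max_of_lt_right hi)]
  | ex n B ih | all n B ih =>
    obtain ⟨N, hN⟩ := ih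
    exact ⟨N, fun σ τ h => by simp only [Fml.subst, hN _ _ (Sub.up_congr n h)]⟩

theorem List.exists_fresh (Γ : List (Fml L)) :
    ∃ N, ∀ A ∈ Γ, ∀ σ τ : Sub L, (∀ n i, i < N → σ n i = τ n i) → A.subst σ = A.subst τ := by
  induction Γ with
  | nil => exact ⟨0, by simp⟩
  | cons A Γ ih =>
    obtain ⟨N, hN⟩ := ih
    obtain ⟨M, hM⟩ := A.exists_fresh
    refine ⟨max N M, fun B hB σ τ h => ?_⟩
    rcases List.mem_cons.1 hB with rfl | hB
    · exact hM σ τ fun n i hi => h n i (lt_max_of_lt_right hi)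
    · exact hN B hB σ τ fun n i hi => h n i (lt_max_of_lt_left hi)

/-- Rename the variable of sort `m` with index `N` to index `0`, and raise the indices of the other
variables of sort `m` by one. -/
def Sub.bindVar (m N : ℕ) : Sub L := fun n i =>
  if n = m ∧ i = N then .var n 0 else Sub.shift m n i

/-- A variable that is fresh for finitely many formulas `Γ` and for `B`, together with a renaming
that turns it into the variable bound by a quantifier over `B`. -/
theorem exists_bindVar (m : ℕ) (Γ : List (Fml L)) (B : Fml L) : ∃ (v : Tm L m) (σ : Sub L),
    (∀ A ∈ Γ, A.subst σ = A.shift m) ∧ (B.inst v).subst σ = B := by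
  obtain ⟨N, hN⟩ := List.exists_fresh (B :: Γ)
  refine ⟨.var m N, Sub.bindVar m N, fun A hA => ?_, ?_⟩
  · refine hN A (List.mem_cons_of_mem _ hA) _ _ fun n i hi => ?_
    rw [Sub.bindVar, if_neg fun h => hi.ne h.2]
  · rw [Fml.inst, Fml.subst_subst]
    conv_rhs => rw [← Fml.subst_vars B]
    refine hN B List.mem_cons_self _ _ fun n i hi => ?_
    rw [Sub.inst_eq_cons, Sub.comp]
    by_cases hn : n = m
    · subst hn
      cases i with
      | zero => simp [Tm.subst, Sub.bindVar, Sub.vars]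
      | succ i => simp [Tm.subst, Sub.bindVar, Sub.vars, Sub.shift, (Nat.lt_of_succ_lt hi).ne]
    · simp [Sub.cons_of_ne hn, Tm.subst, Sub.bindVar, Sub.vars, Sub.shift, hn]

/-- Terms may be open, so a fresh variable is among them. The instance at it is generic, and
renaming it to the bound variable yields the premise of `all_intro`. -/
theorem Der.all_iff [NoApp L] {Γ : List (Fml L)} {n : ℕ} {B : Fml L} :
    Der Γ (.all n B) ↔ ∀ t : Tm L n, Der Γ (B.inst t) := by
  refine ⟨fun d t => .all_elim t d fun h => .den_all _ h t, fun d => ?_⟩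
  obtain ⟨v, σ, hΓ, hB⟩ := exists_bindVar n Γ B
  refine .all_intro ?_
  have := (d v).subst σ
  rwa [hB, List.map_congr_left hΓ] at this

theorem Der.ex_elim_of_forall [NoApp L] {Γ : List (Fml L)} {n : ℕ} {B C : Fml L}
    (d : Der Γ (.ex n B)) (e : ∀ t : Tm L n, Der (B.inst t :: Γ) C) : Der Γ C := by
  -- The variable must be fresh for the conclusion `C` too, as the eigenvariable condition demands.
  obtain ⟨v, σ, hΓ, hB⟩ := exists_bindVar n (C :: Γ) B
  refine .ex_elim d ?_
  have := (e v).subst σ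
  rwa [List.map_cons, hB, List.map_congr_left fun A hA => hΓ A (List.mem_cons_of_mem _ hA),
    hΓ C List.mem_cons_self] at this

/-! ### Truth values -/

/-- The implication from all formulas of `Γ` to `c`. -/
def impList (Γ : List (Fml L)) (c : Fml L) : Fml L := Γ.foldl (fun c A => .imp A c) c

theorem der_impList {Γ Δ : List (Fml L)} {c : Fml L} :
    Der Δ (impList Γ c) ↔ Der (Γ ++ Δ) c := by
  induction Γ generalizing c with
  | nil => exact Iff.rfl
  | cons A Γ ih =>
    refine (ih (c := .imp A c)).trans ⟨fun d => ?_, fun d => .imp_intro d⟩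
    exact .imp_elim (d.weaken (List.subset_cons_self _ _)) (.hyp List.mem_cons_self)

/-- Truth values: properties of lists of hypotheses that are intersections of properties of the
form "`c` is derivable from these and further hypotheses". -/
@[ext] structure Om (L : Lang) where
  holds : List (Fml L) → Prop
  mono : ∀ {Γ Δ}, Γ ⊆ Δ → holds Γ → holds Δ
  stable : ∀ {Γ}, (∀ c, (∀ Δ, Γ ⊆ Δ → holds Δ → Der Δ c) → Der Γ c) → holds Γ

instance : CoeFun (Om L) fun _ => List (Fml L) → Prop := ⟨Om.holds⟩

namespace Om

theorem ext_iff_holds {φ ψ : Om L} (h : ∀ Γ, φ Γ ↔ ψ Γ) : φ = ψ :=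
  Om.ext (funext fun Γ => propext (h Γ))

/-- Derivability of a formula. -/
def ofFml (A : Fml L) : Om L where
  holds Γ := Der Γ A
  mono h d := d.weaken h
  stable h := h A fun _ _ d => d

protected def top : Om L where
  holds _ := True
  mono _ _ := trivial
  stable _ := trivial

protected def and (φ ψ : Om L) : Om L where
  holds Γ := φ Γ ∧ ψ Γ
  mono h := And.imp (φ.mono h) (ψ.mono h)
  stable h := ⟨φ.stable fun c hc => h c fun Δ hΔ d => hc Δ hΔ d.1,
    ψ.stable fun c hc => h c fun Δ hΔ d => hc Δ hΔ d.2⟩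

protected def imp (φ ψ : Om L) : Om L where
  holds Γ := ∀ Δ, Γ ⊆ Δ → φ Δ → ψ Δ
  mono h d := fun Δ hΔ => d Δ (List.Subset.trans h hΔ)
  stable {Γ} h := fun Δ hΔ hφ => ψ.stable fun c hc => by
    -- The test formula `c` is to be derived from `Δ`, while stability is known at `Γ`; discharging
    -- all of `Δ` into the formula makes it a test at `Γ`.
    have : Der Γ (impList Δ c) := h _ fun Θ _ f => der_impList.2 <|
      hc _ (List.subset_append_left _ _) <|
        f _ (List.subset_append_right _ _) (φ.mono (List.subset_append_left _ _) hφ)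
    exact (der_impList.1 this).weaken (List.append_subset.2 ⟨fun _ => id, hΔ⟩)

protected def all {ι : Type} (φ : ι → Om L) : Om L where
  holds Γ := ∀ i, φ i Γ
  mono h d := fun i => (φ i).mono h (d i)
  stable h := fun i => (φ i).stable fun c hc => h c fun Δ hΔ d => hc Δ hΔ (d i)

/-- A union of truth values need not be stable; this is its closure, the least truth value above all
`φ i`. -/
protected def ex {ι : Type} (φ : ι → Om L) : Om L where
  holds Γ := ∀ c, (∀ i Δ, Γ ⊆ Δ → φ i Δ → Der Δ c) → Der Γ c
  mono {Γ Γ'} h d := fun c hc => by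
    have : Der Γ (impList Γ' c) := d _ fun i Δ _ hi => der_impList.2 <|
      hc i _ (List.subset_append_left _ _) ((φ i).mono (List.subset_append_right _ _) hi)
    exact (der_impList.1 this).weaken (List.append_subset.2 ⟨fun _ => id, h⟩)
  stable h := fun c hc => h c fun Δ hΔ d => d c fun i Θ hΘ => hc i Θ (List.Subset.trans hΔ hΘ)

protected def bot : Om L := ofFml .bot

protected def or (φ ψ : Om L) : Om L := Om.ex fun b : Bool => cond b φ ψ

protected def iff (φ ψ : Om L) : Om L := (φ.imp ψ).and (ψ.imp φ)

protected def eq {n : ℕ} (a b : Tm L n) : Om L := ofFml (.eq a b)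

protected def mem {n : ℕ} (a : Tm L n) (b : Tm L (n + 1)) : Om L := ofFml (.mem a b)

variable {Γ : List (Fml L)} {φ ψ χ : Om L}

theorem ex_intro {ι : Type} {φ : ι → Om L} (i : ι) (h : φ i Γ) : Om.ex φ Γ :=
  fun _ hc => hc i Γ (fun _ => id) h

/-- The definition eliminates only into derivability of a formula; stability of `ψ` extends this to
every truth value. -/
theorem ex_elim {ι : Type} {φ : ι → Om L} (h : Om.ex φ Γ)
    (k : ∀ i Δ, Γ ⊆ Δ → φ i Δ → ψ Δ) : ψ Γ :=
  ψ.stable fun c hc => h c fun i Δ hΔ hi => hc Δ hΔ (k i Δ hΔ hi)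

theorem or_inl (h : φ Γ) : (φ.or ψ) Γ := ex_intro true h

theorem or_inr (h : ψ Γ) : (φ.or ψ) Γ := ex_intro false h

theorem or_elim (h : (φ.or ψ) Γ) (h₁ : ∀ Δ, Γ ⊆ Δ → φ Δ → χ Δ)
    (h₂ : ∀ Δ, Γ ⊆ Δ → ψ Δ → χ Δ) : χ Γ :=
  ex_elim h fun b => match b with
    | true => h₁
    | false => h₂

theorem bot_elim (h : Om.bot Γ) : φ Γ := φ.stable fun _ _ => .bot_elim h

theorem imp_elim (h : (φ.imp ψ) Γ) (h' : φ Γ) : ψ Γ := h Γ (fun _ => id) h'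

theorem iff_mp (h : (φ.iff ψ) Γ) (h' : φ Γ) : ψ Γ := imp_elim h.1 h'

theorem iff_mpr (h : (φ.iff ψ) Γ) (h' : ψ Γ) : φ Γ := imp_elim h.2 h'

theorem ofFml_top : ofFml (.top : Fml L) = Om.top :=
  ext_iff_holds fun _ => ⟨fun _ => trivial, fun _ => .top_intro⟩

theorem ofFml_and (A B : Fml L) : ofFml (.and A B) = (ofFml A).and (ofFml B) :=
  ext_iff_holds fun _ => ⟨fun d => ⟨.and_left d, .and_right d⟩, fun d => .and_intro d.1 d.2⟩

theorem ofFml_imp (A B : Fml L) : ofFml (.imp A B) = (ofFml A).imp (ofFml B) :=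
  ext_iff_holds fun _ => ⟨fun d _ h e => .imp_elim (d.weaken h) e,
    fun d => .imp_intro (d _ (List.subset_cons_self _ _) (.hyp List.mem_cons_self))⟩

theorem ofFml_or (A B : Fml L) : ofFml (.or A B) = (ofFml A).or (ofFml B) :=
  ext_iff_holds fun _ =>
    ⟨fun d _ h => .or_elim d (h true _ (List.subset_cons_self _ _) (.hyp List.mem_cons_self))
      (h false _ (List.subset_cons_self _ _) (.hyp List.mem_cons_self)),
    fun d => or_elim d (fun _ _ => .or_left) fun _ _ => .or_right⟩

theorem ofFml_iff (A B : Fml L) : ofFml (.iff A B) = (ofFml A).iff (ofFml B) := by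
  rw [Fml.iff, ofFml_and, ofFml_imp, ofFml_imp, Om.iff]

theorem ofFml_all [NoApp L] (n : ℕ) (B : Fml L) :
    ofFml (.all n B) = Om.all fun t : Tm L n => ofFml (B.inst t) :=
  ext_iff_holds fun _ => Der.all_iff

theorem ofFml_ex [NoApp L] (n : ℕ) (B : Fml L) :
    ofFml (.ex n B) = Om.ex fun t : Tm L n => ofFml (B.inst t) :=
  ext_iff_holds fun _ =>
    ⟨fun d _ h => Der.ex_elim_of_forall d fun t =>
      h t _ (List.subset_cons_self _ _) (.hyp List.mem_cons_self),
    fun d => ex_elim d fun t _ _ e => .ex_intro t e fun h => .den_all _ h t⟩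

/-! ### Definability -/

/-- A term depending on a valuation is definable. -/
def DT {n : ℕ} (g : Sub L → Tm L n) : Prop := ∃ a : Tm L n, ∀ ρ, g ρ = a.subst ρ

/-- A valuation depending on a valuation is definable. -/
def DS (r : Sub L → Sub L) : Prop := ∀ n i, DT fun ρ => r ρ n i

/-- A truth value depending on a valuation is definable. -/
def D (f : Sub L → Om L) : Prop := ∃ A : Fml L, ∀ ρ, f ρ = ofFml (A.subst ρ)

theorem DT.get {r : Sub L → Sub L} (h : DS r) (n i : ℕ) : DT fun ρ => r ρ n i := h n i

theorem DS.id : DS fun ρ : Sub L => ρ := fun n i => ⟨.var n i, fun _ => rfl⟩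

theorem DT.var (n i : ℕ) : DT fun ρ : Sub L => ρ n i := DS.id n i

theorem DS.tail {r : Sub L → Sub L} (h : DS r) (m : ℕ) : DS fun ρ => Sub.tail m (r ρ) := by
  intro n i
  by_cases hn : n = m
  · subst hn
    simpa only [Sub.tail_self] using h n (i + 1)
  · simpa only [Sub.tail_of_ne hn] using h n i

theorem DT.comp {n : ℕ} {g : Sub L → Tm L n} (h : DT g) {r : Sub L → Sub L} (hr : DS r) :
    DT fun ρ => g (r ρ) := by
  obtain ⟨a, ha⟩ := h
  choose σ hσ using hr
  refine ⟨a.subst σ, fun ρ => ?_⟩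
  beta_reduce
  rw [ha, Tm.subst_subst]
  congr 1
  funext n i
  exact hσ n i ρ

/-- Moves a parameter under a quantifier of sort `m`: there it reads the valuation with the bound
variable removed. -/
theorem DT.comp_tail {n : ℕ} {g : Sub L → Tm L n} (h : DT g) (m : ℕ) :
    DT fun ρ => g (Sub.tail m ρ) :=
  h.comp (DS.id.tail m)

theorem DS.comp_tail {r : Sub L → Sub L} (h : DS r) (m : ℕ) :
    DS fun ρ => r (Sub.tail m ρ) :=
  fun n i => (h n i).comp_tail m

theorem DS.cons {m : ℕ} {g : Sub L → Tm L m} {r : Sub L → Sub L} (hg : DT g) (hr : DS r) :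
    DS fun ρ => Sub.cons (g ρ) (r ρ) := by
  intro n i
  by_cases hn : n = m
  · subst hn
    cases i with
    | zero => simpa only [Sub.cons_zero] using hg
    | succ i => simpa only [Sub.cons_succ] using hr n i
  · simpa only [Sub.cons_of_ne hn] using hr n i

theorem DT.zero : DT fun _ : Sub L => Tm.zero := ⟨.zero, fun _ => rfl⟩

theorem DT.succ {g : Sub L → Tm L 0} (h : DT g) : DT fun ρ => .succ (g ρ) := by
  obtain ⟨a, ha⟩ := h
  exact ⟨.succ a, fun ρ => by beta_reduce; rw [ha]; rfl⟩

theorem DT.add {g g' : Sub L → Tm L 0} (h : DT g) (h' : DT g') :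
    DT fun ρ => .add (g ρ) (g' ρ) := by
  obtain ⟨a, ha⟩ := h
  obtain ⟨b, hb⟩ := h'
  exact ⟨.add a b, fun ρ => by beta_reduce; rw [ha, hb]; rfl⟩

theorem DT.mul {g g' : Sub L → Tm L 0} (h : DT g) (h' : DT g') :
    DT fun ρ => .mul (g ρ) (g' ρ) := by
  obtain ⟨a, ha⟩ := h
  obtain ⟨b, hb⟩ := h'
  exact ⟨.mul a b, fun ρ => by beta_reduce; rw [ha, hb]; rfl⟩

theorem D.eq {n : ℕ} {g g' : Sub L → Tm L n} (h : DT g) (h' : DT g') :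
    D fun ρ => Om.eq (g ρ) (g' ρ) := by
  obtain ⟨a, ha⟩ := h
  obtain ⟨b, hb⟩ := h'
  exact ⟨.eq a b, fun ρ => by beta_reduce; rw [ha, hb]; rfl⟩

theorem D.mem {n : ℕ} {g : Sub L → Tm L n} {g' : Sub L → Tm L (n + 1)} (h : DT g)
    (h' : DT g') : D fun ρ => Om.mem (g ρ) (g' ρ) := by
  obtain ⟨a, ha⟩ := h
  obtain ⟨b, hb⟩ := h'
  exact ⟨.mem a b, fun ρ => by beta_reduce; rw [ha, hb]; rfl⟩

theorem D.top : D fun _ : Sub L => Om.top := ⟨.top, fun _ => ofFml_top.symm⟩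

theorem D.bot : D fun _ : Sub L => Om.bot := ⟨.bot, fun _ => rfl⟩

theorem D.and {f f' : Sub L → Om L} (h : D f) (h' : D f') : D fun ρ => (f ρ).and (f' ρ) := by
  obtain ⟨A, hA⟩ := h
  obtain ⟨B, hB⟩ := h'
  exact ⟨.and A B, fun ρ => by beta_reduce; rw [hA, hB]; exact (ofFml_and _ _).symm⟩

theorem D.or {f f' : Sub L → Om L} (h : D f) (h' : D f') : D fun ρ => (f ρ).or (f' ρ) := by
  obtain ⟨A, hA⟩ := h
  obtain ⟨B, hB⟩ := h'
  exact ⟨.or A B, fun ρ => by beta_reduce; rw [hA, hB]; exact (ofFml_or _ _).symm⟩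

theorem D.imp {f f' : Sub L → Om L} (h : D f) (h' : D f') : D fun ρ => (f ρ).imp (f' ρ) := by
  obtain ⟨A, hA⟩ := h
  obtain ⟨B, hB⟩ := h'
  exact ⟨.imp A B, fun ρ => by beta_reduce; rw [hA, hB]; exact (ofFml_imp _ _).symm⟩

/-- Reading the quantified term from index `0` and the parameters from the tail turns a
metatheoretic function of `t` into a formula under a binder. -/
theorem D.all [NoApp L] {n : ℕ} {f : Tm L n → Sub L → Om L}
    (h : D fun ρ => f (ρ n 0) (Sub.tail n ρ)) : D fun ρ => Om.all fun t => f t ρ := by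
  obtain ⟨A, hA⟩ := h
  refine ⟨.all n A, fun ρ => (Eq.trans (ofFml_all _ _) (congrArg _ (funext fun t => ?_))).symm⟩
  rw [Fml.subst_up_inst, ← hA]
  beta_reduce
  rw [Sub.cons_zero, Sub.tail_cons]

theorem D.ex [NoApp L] {n : ℕ} {f : Tm L n → Sub L → Om L}
    (h : D fun ρ => f (ρ n 0) (Sub.tail n ρ)) : D fun ρ => Om.ex fun t => f t ρ := by
  obtain ⟨A, hA⟩ := h
  refine ⟨.ex n A, fun ρ => (Eq.trans (ofFml_ex _ _) (congrArg _ (funext fun t => ?_))).symm⟩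
  rw [Fml.subst_up_inst, ← hA]
  beta_reduce
  rw [Sub.cons_zero, Sub.tail_cons]

/-- A finite conjunction is a formula; this serves the quantification over the tags of the
combinators. -/
theorem D.all_finite [NoApp L] {ι : Type} [Finite ι] {f : ι → Sub L → Om L}
    (h : ∀ i, D (f i)) : D fun ρ => Om.all fun i => f i ρ := by
  choose A hA using h
  obtain ⟨l, hl⟩ : ∃ l : List ι, ∀ i, i ∈ l :=
    ⟨(Set.finite_univ (α := ι)).toFinset.toList, fun i => by simp⟩
  suffices H : ∀ l : List ι, ∃ B : Fml L, ∀ ρ Γ, Der Γ (B.subst ρ) ↔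
      ∀ i ∈ l, Der Γ ((A i).subst ρ) by
    obtain ⟨B, hB⟩ := H l
    refine ⟨B, fun ρ => ext_iff_holds fun Γ => ?_⟩
    refine Iff.trans (forall_congr' fun i => ?_) (hB ρ Γ).symm
    beta_reduce
    rw [hA]
    exact ⟨fun h _ => h, fun h => h (hl i)⟩
  intro l
  induction l with
  | nil => exact ⟨.top, fun ρ Γ => ⟨fun _ => by simp, fun _ => .top_intro⟩⟩
  | cons i l ih =>
    obtain ⟨B, hB⟩ := ih
    refine ⟨.and (A i) B, fun ρ Γ => ?_⟩
    rw [List.forall_mem_cons, ← hB]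
    exact ⟨fun d => ⟨.and_left d, .and_right d⟩, fun d => .and_intro d.1 d.2⟩

/-! ### Codes -/

/-- An injective pairing of numbers. -/
def pair (x y : Tm L 0) : Tm L 0 := .add (.mul (.add x y) (.add x y)) x

theorem DT.pair {g g' : Sub L → Tm L 0} (h : DT g) (h' : DT g') :
    DT fun ρ => pair (g ρ) (g' ρ) :=
  .add (.mul (.add h h') (.add h h')) h

/-- Numerals. -/
def numeral : ℕ → Tm L 0
  | 0 => .zero
  | n + 1 => .succ (numeral n)

theorem DT.numeral (n : ℕ) : DT fun _ : Sub L => numeral n := by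
  induction n with
  | zero => exact .zero
  | succ n ih => exact .succ ih

/-- Codes of combinators applied to at most two arguments. -/
def code (t : ℕ) (x y : Tm L 0) : Tm L 0 := pair (numeral t) (pair x y)

theorem DT.code (t : ℕ) {g g' : Sub L → Tm L 0} (h : DT g) (h' : DT g') :
    DT fun ρ => code t (g ρ) (g' ρ) :=
  .pair (.numeral t) (.pair h h')

/-! ### Equality, induction and comprehension for definable truth values -/

theorem eq_refl [NoApp L] (Γ : List (Fml L)) {n : ℕ} (a : Tm L n) : Om.eq a a Γ :=
  Der.eq_refl a fun h => .den_all _ h a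

/-- Leibniz's rule. Definability is needed, since an arbitrary family of truth values may
distinguish provably equal terms. -/
theorem D.resp {f : Sub L → Om L} (hf : D f) {n : ℕ} {a b : Tm L n} (ρ : Sub L)
    (h : Om.eq a b Γ) (h' : f (Sub.cons a ρ) Γ) : f (Sub.cons b ρ) Γ := by
  obtain ⟨A, hA⟩ := hf
  rw [hA, ← Fml.subst_up_inst] at h' ⊢
  exact Der.eq_subst _ h h'

theorem eq_congr [NoApp L] {m n : ℕ} {g : Sub L → Tm L m} (hg : DT g) {a b : Tm L n}
    (ρ : Sub L) (h : Om.eq a b Γ) : Om.eq (g (Sub.cons a ρ)) (g (Sub.cons b ρ)) Γ := by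
  -- Leibniz's rule for `g a = g x`, where `a` stays fixed at index `1` and `x`, at index `0`,
  -- changes from `a` to `b`.
  have := (D.eq (hg.comp_tail n) (hg.comp (r := fun ρ => Sub.cons (ρ n 0)
    (Sub.tail n (Sub.tail n ρ))) (DS.cons (.var _ _) (.tail (.tail .id _) _)))).resp
    (Sub.cons a ρ) h
  simp only [Sub.cons_zero, Sub.tail_cons] at this
  exact this (eq_refl _ _)

theorem eq_symm [NoApp L] {n : ℕ} {a b : Tm L n} (h : Om.eq a b Γ) : Om.eq b a Γ := by
  have := (D.eq (DT.var n 0) (DT.var n 1)).resp (Sub.cons a Sub.vars) h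
  simp only [Sub.cons_zero, Sub.cons_succ] at this
  exact this (eq_refl _ _)

theorem eq_trans {n : ℕ} {a b c : Tm L n} (h : Om.eq a b Γ) (h' : Om.eq b c Γ) :
    Om.eq a c Γ := by
  have := (D.eq (DT.var n 1) (DT.var n 0)).resp (Sub.cons a Sub.vars) h'
  simp only [Sub.cons_zero, Sub.cons_succ] at this
  exact this h

/-- The step is required over all larger contexts because the induction hypothesis is itself added
to the context. -/
theorem D.induction [NoApp L] {f : Sub L → Om L} (hf : D f) (ρ : Sub L)
    (h₀ : f (Sub.cons (m := 0) .zero ρ) Γ)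
    (h₁ : ∀ (x : Tm L 0) Δ, Γ ⊆ Δ → f (Sub.cons x ρ) Δ → f (Sub.cons (.succ x) ρ) Δ)
    (x : Tm L 0) : f (Sub.cons x ρ) Γ := by
  obtain ⟨A, hA⟩ := hf
  simp only [hA, ← Fml.subst_up_inst] at *
  refine Der.all_iff.1 (.imp_elim (.ax (.ind _)) (.and_intro h₀ (Der.all_iff.2 fun y => ?_))) x
  refine .imp_intro ?_
  have := h₁ y _ (List.subset_cons_self _ _) (.hyp List.mem_cons_self)
  have e : ((A.subst (Sub.up 0 ρ)).subst Sub.succ).inst y =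
      (A.subst (Sub.up 0 ρ)).inst (.succ y) := by
    rw [Fml.inst, Fml.inst, Fml.subst_subst (Fml.subst _ A)]
    congr 1
    rw [Sub.succ_eq_cons, Sub.cons_comp, Sub.comp_assoc, Sub.inst_eq_cons, Sub.shift_comp_cons]
    rfl
  change Der _ (((A.subst (Sub.up 0 ρ)).subst Sub.succ).inst y)
  rw [e]
  exact this

theorem D.comprehension [NoApp L] {f : Sub L → Om L} (hf : D f) (n : ℕ) (ρ : Sub L)
    (Γ : List (Fml L)) :
    Om.ex (fun X : Tm L (n + 1) => Om.all fun z : Tm L n =>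
      Om.iff (Om.mem z X) (f (Sub.cons z ρ))) Γ := by
  obtain ⟨A, hA⟩ := hf
  have : ofFml _ Γ := Der.ax (Ax.compr n (A.subst (Sub.up n ρ)))
  rw [ofFml_ex] at this
  refine Eq.mp (congrFun (congrArg _ (congrArg _ (funext fun X => ?_))) Γ) this
  refine Eq.trans (ofFml_all _ _) (congrArg _ (funext fun z => ?_))
  rw [Fml.subst_up_inst, hA]
  refine Eq.trans (ofFml_iff _ _) ?_
  congr 2
  · simp only [Fml.subst, Tm.subst, Sub.cons_zero]
    rw [Sub.cons_of_ne (by omega), Sub.inst_eq_cons, Sub.cons_zero]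
  · rw [Fml.shift, Fml.subst_subst (Fml.subst _ A), Sub.inst_eq_cons]
    change Fml.subst (Sub.tail _ _) _ = _
    rw [Sub.tail_cons_of_ne (by omega), Sub.tail_cons]
    exact Fml.subst_up_inst _ _ _

end Om

namespace Om

variable [NoApp L]

/-! ### Arithmetic -/

theorem eq_zero_add (Γ : List (Fml L)) (y : Tm L 0) : Om.eq (.add .zero y) y Γ :=
  .all_elim' y (.ax .zero_add) (fun h => .den_all _ h y) rfl

theorem eq_zero_mul (Γ : List (Fml L)) (y : Tm L 0) : Om.eq (.mul .zero y) .zero Γ :=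
  .all_elim' y (.ax .zero_mul) (fun h => .den_all _ h y) rfl

theorem eq_succ_add (Γ : List (Fml L)) (x y : Tm L 0) :
    Om.eq (.add (.succ x) y) (.succ (.add x y)) Γ := by
  refine .all_elim' y (.all_elim' x (.ax .succ_add) (fun h => .den_all _ h x) rfl)
    (fun h => .den_all _ h y) ?_
  simp [Fml.inst, Fml.subst, Tm.subst, Sub.inst_eq_cons, Tm.subst_subst,
    Sub.shift_comp_cons, Tm.subst_vars]

theorem eq_succ_mul (Γ : List (Fml L)) (x y : Tm L 0) :
    Om.eq (.mul (.succ x) y) (.add (.mul x y) y) Γ := by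
  refine .all_elim' y (.all_elim' x (.ax .succ_mul) (fun h => .den_all _ h x) rfl)
    (fun h => .den_all _ h y) ?_
  simp [Fml.inst, Fml.subst, Tm.subst, Sub.inst_eq_cons, Tm.subst_subst,
    Sub.shift_comp_cons, Tm.subst_vars]

theorem succ_ne_zero {Γ : List (Fml L)} {x : Tm L 0} (h : Om.eq (.succ x) .zero Γ) :
    Om.bot Γ :=
  Der.imp_elim (.all_elim' x (.ax .succ_ne_zero) (fun h => .den_all _ h x) rfl) h

theorem succ_inj {Γ : List (Fml L)} {x y : Tm L 0} (h : Om.eq (.succ x) (.succ y) Γ) :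
    Om.eq x y Γ := by
  refine .imp_elim (.all_elim' y (.all_elim' x (.ax .succ_inj) (fun h => .den_all _ h x) rfl)
    (fun h => .den_all _ h y) ?_) h
  simp [Fml.inst, Fml.subst, Tm.subst, Sub.inst_eq_cons, Tm.subst_subst,
    Sub.shift_comp_cons, Tm.subst_vars]

/-- Provable equality from the hypotheses `Γ`. -/
def eqSetoid (Γ : List (Fml L)) : Setoid (Tm L 0) where
  r a b := Om.eq a b Γ
  iseqv := ⟨eq_refl Γ, eq_symm, eq_trans⟩

/-- The numbers, up to provable equality from the hypotheses `Γ`. -/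
def Number (Γ : List (Fml L)) : Type := Quotient (eqSetoid Γ)

namespace Number

variable {Γ : List (Fml L)}

/-- The class of a term. -/
def cls (Γ : List (Fml L)) (a : Tm L 0) : Number Γ := Quotient.mk (eqSetoid Γ) a

theorem cls_eq {a b : Tm L 0} : cls Γ a = cls Γ b ↔ Om.eq a b Γ :=
  Quotient.eq (r := eqSetoid Γ)

theorem exists_cls (q : Number Γ) : ∃ a, cls Γ a = q := Quotient.exists_rep q

theorem eq_congr₂ {g : Sub L → Tm L 0} (hg : DT g) {a a' b b' : Tm L 0}
    (ha : Om.eq a a' Γ) (hb : Om.eq b b' Γ) :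
    Om.eq (g (.cons a (.cons b Sub.vars))) (g (.cons a' (.cons b' Sub.vars))) Γ := by
  refine eq_trans (eq_congr hg _ ha) ?_
  have := eq_congr (hg.comp (r := fun ρ => Sub.cons (ρ 0 1) (Sub.cons (ρ 0 0)
    (Sub.tail 0 (Sub.tail 0 ρ)))) (DS.cons (.var _ _) (.cons (.var _ _) (.tail (.tail .id _) _))))
    (Sub.cons a' Sub.vars) hb
  simpa only [Sub.cons_zero, Sub.cons_succ, Sub.tail_cons] using this

instance : Zero (Number Γ) := ⟨cls Γ .zero⟩

instance : One (Number Γ) := ⟨cls Γ (.succ .zero)⟩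

instance : Add (Number Γ) := ⟨Quotient.map₂ .add fun _ _ ha _ _ hb => by
  change Om.eq _ _ Γ
  simpa using eq_congr₂ (DT.add (.var 0 0) (.var 0 1)) ha hb⟩

instance : Mul (Number Γ) := ⟨Quotient.map₂ .mul fun _ _ ha _ _ hb => by
  change Om.eq _ _ Γ
  simpa using eq_congr₂ (DT.mul (.var 0 0) (.var 0 1)) ha hb⟩

/-- The successor. -/
def succ : Number Γ → Number Γ := Quotient.map .succ fun _ _ ha => by
  change Om.eq _ _ Γ
  simpa using eq_congr (DT.succ (.var 0 0)) Sub.vars ha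

theorem cls_zero : cls Γ .zero = 0 := rfl

theorem cls_add (a b : Tm L 0) : cls Γ (.add a b) = cls Γ a + cls Γ b := rfl

theorem cls_mul (a b : Tm L 0) : cls Γ (.mul a b) = cls Γ a * cls Γ b := rfl

theorem cls_succ' (a : Tm L 0) : cls Γ (.succ a) = succ (cls Γ a) := rfl

theorem zero_add' (y : Number Γ) : 0 + y = y := by
  obtain ⟨y, rfl⟩ := exists_cls y
  exact cls_eq.2 (Om.eq_zero_add Γ y)

theorem zero_mul' (y : Number Γ) : 0 * y = 0 := by
  obtain ⟨y, rfl⟩ := exists_cls y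
  exact cls_eq.2 (Om.eq_zero_mul Γ y)

theorem succ_add' (x y : Number Γ) : succ x + y = succ (x + y) := by
  obtain ⟨x, rfl⟩ := exists_cls x
  obtain ⟨y, rfl⟩ := exists_cls y
  exact cls_eq.2 (Om.eq_succ_add Γ x y)

theorem succ_mul' (x y : Number Γ) : succ x * y = x * y + y := by
  obtain ⟨x, rfl⟩ := exists_cls x
  obtain ⟨y, rfl⟩ := exists_cls y
  exact cls_eq.2 (Om.eq_succ_mul Γ x y)

/-- Induction changes the context, so the step speaks of the quotient `Number Δ` for arbitrary `Δ`,
and the statement is about representing terms. The parameters `y` and `z` suffice for the semiring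
laws. -/
theorem eq_induction {g g' : Sub L → Tm L 0} (hg : DT g) (hg' : DT g') (y z : Tm L 0)
    (h₀ : cls Γ (g (.cons (m := 0) .zero (.cons y (.cons z Sub.vars)))) =
      cls Γ (g' (.cons (m := 0) .zero (.cons y (.cons z Sub.vars)))))
    (h₁ : ∀ (x : Tm L 0) (Δ : List (Fml L)),
      cls Δ (g (.cons x (.cons y (.cons z Sub.vars)))) =
        cls Δ (g' (.cons x (.cons y (.cons z Sub.vars)))) →
      cls Δ (g (.cons (.succ x) (.cons y (.cons z Sub.vars)))) =
        cls Δ (g' (.cons (.succ x) (.cons y (.cons z Sub.vars))))) (x : Tm L 0) :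
    cls Γ (g (.cons x (.cons y (.cons z Sub.vars)))) =
      cls Γ (g' (.cons x (.cons y (.cons z Sub.vars)))) :=
  cls_eq.2 <| (D.eq hg hg').induction _ (cls_eq.1 h₀)
    (fun x Δ _ h => cls_eq.1 (h₁ x Δ (cls_eq.2 h))) x

theorem add_zero' (x : Number Γ) : x + 0 = x := by
  obtain ⟨x, rfl⟩ := exists_cls x
  have := eq_induction (Γ := Γ) (DT.add (.var 0 0) .zero) (.var 0 0) .zero .zero
  simp only [Sub.cons_zero, cls_add, cls_succ', cls_zero, zero_add', true_implies] at this
  exact this (fun x Δ h => by rw [succ_add', h]) x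

theorem add_succ' (x y : Number Γ) : x + succ y = succ (x + y) := by
  obtain ⟨x, rfl⟩ := exists_cls x
  obtain ⟨y, rfl⟩ := exists_cls y
  have := eq_induction (Γ := Γ) (DT.add (.var 0 0) (.succ (.var 0 1)))
    (.succ (.add (.var 0 0) (.var 0 1))) y .zero
  simp only [Sub.cons_zero, Sub.cons_succ, cls_add, cls_succ', cls_zero, zero_add',
    true_implies] at this
  exact this (fun x Δ h => by rw [succ_add', h, succ_add']) x

theorem add_comm' (x y : Number Γ) : x + y = y + x := by
  obtain ⟨x, rfl⟩ := exists_cls x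
  obtain ⟨y, rfl⟩ := exists_cls y
  have := eq_induction (Γ := Γ) (DT.add (.var 0 0) (.var 0 1))
    (.add (.var 0 1) (.var 0 0)) y .zero
  simp only [Sub.cons_zero, Sub.cons_succ, cls_add, cls_succ', cls_zero, zero_add', add_zero',
    true_implies] at this
  exact this (fun x Δ h => by rw [succ_add', h, add_succ']) x

theorem add_assoc' (x y z : Number Γ) : x + y + z = x + (y + z) := by
  obtain ⟨x, rfl⟩ := exists_cls x
  obtain ⟨y, rfl⟩ := exists_cls y
  obtain ⟨z, rfl⟩ := exists_cls z
  have := eq_induction (Γ := Γ) (DT.add (.add (.var 0 0) (.var 0 1)) (.var 0 2))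
    (.add (.var 0 0) (.add (.var 0 1) (.var 0 2))) y z
  simp only [Sub.cons_zero, Sub.cons_succ, cls_add, cls_succ', cls_zero, zero_add',
    true_implies] at this
  exact this (fun x Δ h => by rw [succ_add', succ_add', h, succ_add']) x

instance : AddCommMonoid (Number Γ) where
  add_assoc := add_assoc'
  zero_add := zero_add'
  add_zero := add_zero'
  add_comm := add_comm'
  nsmul := nsmulRec

theorem succ_eq (x : Number Γ) : succ x = x + 1 := by
  rw [← add_zero' x, ← add_succ', add_zero']
  rfl

theorem cls_succ (a : Tm L 0) : cls Γ (.succ a) = cls Γ a + 1 := succ_eq (cls Γ a)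

theorem succ_mul_one (x y : Number Γ) : (x + 1) * y = x * y + y := by
  rw [← succ_eq, succ_mul']

theorem mul_zero' (x : Number Γ) : x * 0 = 0 := by
  obtain ⟨x, rfl⟩ := exists_cls x
  have := eq_induction (Γ := Γ) (DT.mul (.var 0 0) .zero) .zero .zero .zero
  simp only [Sub.cons_zero, cls_mul, cls_succ, cls_zero, zero_mul', true_implies] at this
  exact this (fun x Δ h => by rw [succ_mul_one, h, add_zero]) x

theorem mul_add_one' (x y : Number Γ) : x * (y + 1) = x * y + x := by
  obtain ⟨x, rfl⟩ := exists_cls x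
  obtain ⟨y, rfl⟩ := exists_cls y
  have := eq_induction (Γ := Γ) (DT.mul (.var 0 0) (.succ (.var 0 1)))
    (.add (.mul (.var 0 0) (.var 0 1)) (.var 0 0)) y .zero
  simp only [Sub.cons_zero, Sub.cons_succ, cls_add, cls_mul, cls_succ, cls_zero, zero_mul',
    add_zero, true_implies] at this
  exact this (fun x Δ h => by rw [succ_mul_one, h, succ_mul_one]; abel) x

theorem mul_comm' (x y : Number Γ) : x * y = y * x := by
  obtain ⟨x, rfl⟩ := exists_cls x
  obtain ⟨y, rfl⟩ := exists_cls y
  have := eq_induction (Γ := Γ) (DT.mul (.var 0 0) (.var 0 1))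
    (.mul (.var 0 1) (.var 0 0)) y .zero
  simp only [Sub.cons_zero, Sub.cons_succ, cls_mul, cls_succ, cls_zero, zero_mul', mul_zero',
    true_implies] at this
  exact this (fun x Δ h => by rw [succ_mul_one, h, mul_add_one']) x

theorem add_mul' (x y z : Number Γ) : (x + y) * z = x * z + y * z := by
  obtain ⟨x, rfl⟩ := exists_cls x
  obtain ⟨y, rfl⟩ := exists_cls y
  obtain ⟨z, rfl⟩ := exists_cls z
  have := eq_induction (Γ := Γ) (DT.mul (.add (.var 0 0) (.var 0 1)) (.var 0 2))
    (.add (.mul (.var 0 0) (.var 0 2)) (.mul (.var 0 1) (.var 0 2))) y z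
  simp only [Sub.cons_zero, Sub.cons_succ, cls_add, cls_mul, cls_succ, cls_zero, zero_add,
    zero_mul', true_implies] at this
  exact this (fun x Δ h => by rw [add_right_comm, succ_mul_one, h, succ_mul_one]; abel) x

theorem mul_assoc' (x y z : Number Γ) : x * y * z = x * (y * z) := by
  obtain ⟨x, rfl⟩ := exists_cls x
  obtain ⟨y, rfl⟩ := exists_cls y
  obtain ⟨z, rfl⟩ := exists_cls z
  have := eq_induction (Γ := Γ) (DT.mul (.mul (.var 0 0) (.var 0 1)) (.var 0 2))
    (.mul (.var 0 0) (.mul (.var 0 1) (.var 0 2))) y z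
  simp only [Sub.cons_zero, Sub.cons_succ, cls_mul, cls_succ, cls_zero, zero_mul',
    true_implies] at this
  exact this (fun x Δ h => by rw [succ_mul_one, add_mul', h, succ_mul_one]) x

/-- Makes `ring` available for provable identities between terms. -/
instance : CommSemiring (Number Γ) where
  left_distrib x y z := by rw [mul_comm', add_mul', mul_comm' y, mul_comm' z]
  right_distrib := add_mul'
  zero_mul := zero_mul'
  mul_zero := mul_zero'
  mul_assoc := mul_assoc'
  one_mul x := by rw [← zero_add (1 : Number Γ), succ_mul_one, zero_mul', zero_add]
  mul_one x := by rw [← zero_add (1 : Number Γ), mul_add_one', mul_zero', zero_add]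
  mul_comm := mul_comm'

theorem add_one_ne_zero {x : Number Γ} (h : x + 1 = 0) : Om.bot Γ := by
  obtain ⟨x, rfl⟩ := exists_cls x
  rw [← cls_succ, ← cls_zero, cls_eq] at h
  exact Om.succ_ne_zero h

theorem add_one_inj {x y : Number Γ} (h : x + 1 = y + 1) : x = y := by
  obtain ⟨x, rfl⟩ := exists_cls x
  obtain ⟨y, rfl⟩ := exists_cls y
  rw [← cls_succ, ← cls_succ, cls_eq] at h
  exact cls_eq.2 (Om.succ_inj h)

theorem add_left_cancel {x y z : Number Γ} (h : x + y = x + z) : y = z := by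
  obtain ⟨x, rfl⟩ := exists_cls x
  obtain ⟨y, rfl⟩ := exists_cls y
  obtain ⟨z, rfl⟩ := exists_cls z
  -- The premise depends on `x`, so the induction is on the implication as a whole.
  have hD : D fun ρ : Sub L => (Om.eq (.add (ρ 0 0) (ρ 0 1)) (.add (ρ 0 0) (ρ 0 2))).imp
      (Om.eq (ρ 0 1) (ρ 0 2)) :=
    .imp (.eq (.add (.var _ _) (.var _ _)) (.add (.var _ _) (.var _ _)))
      (.eq (.var _ _) (.var _ _))
  have := hD.induction (Γ := Γ) (.cons y (.cons z Sub.vars))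
  simp only [Sub.cons_zero, Sub.cons_succ] at this
  refine cls_eq.2 (imp_elim (this ?_ ?_ x) (cls_eq.1 h))
  · intro Δ _ h
    rw [← cls_eq, cls_add, cls_add, cls_zero, zero_add, zero_add] at h
    exact cls_eq.1 h
  · intro x Δ _ ih Θ hΘ h
    refine ih Θ hΘ ?_
    rw [← cls_eq, cls_add, cls_add, cls_succ, add_right_comm, add_right_comm _ 1] at h
    exact cls_eq.1 (add_one_inj h)

end Number

open Number (cls cls_eq cls_zero cls_add cls_mul cls_succ add_left_cancel
  add_one_ne_zero)

/-! ### Comparison of numbers and injectivity of the coding -/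

theorem zero_or_succ (Γ : List (Fml L)) (x : Tm L 0) :
    ((Om.eq x .zero).or (Om.ex fun y : Tm L 0 => Om.eq x (.succ y))) Γ := by
  have hD : D fun ρ : Sub L => (Om.eq (ρ 0 0) .zero).or
      (Om.ex fun y : Tm L 0 => Om.eq (ρ 0 0) (.succ y)) :=
    .or (.eq (.var _ _) .zero) (.ex (.eq (.get (.tail .id _) _ _) (.succ (.var _ _))))
  have := hD.induction (Γ := Γ) Sub.vars
  simp only [Sub.cons_zero] at this
  exact this (or_inl (eq_refl _ _)) (fun x Δ _ _ => or_inr (ex_intro x (eq_refl _ _))) x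

/-- Induction on `x`. If `y = x + d`, then whether `d` is zero or a successor decides the case for
the successor of `x`; in the other case the difference grows by one. -/
theorem le_or_lt (Γ : List (Fml L)) (x y : Tm L 0) :
    ((Om.ex fun d : Tm L 0 => Om.eq y (.add x d)).or
      (Om.ex fun d : Tm L 0 => Om.eq x (.add y (.succ d)))) Γ := by
  have hD : D fun ρ : Sub L => (Om.ex fun d : Tm L 0 => Om.eq (ρ 0 1) (.add (ρ 0 0) d)).or
      (Om.ex fun d : Tm L 0 => Om.eq (ρ 0 0) (.add (ρ 0 1) (.succ d))) :=
    .or (.ex (.eq (.get (.tail .id _) _ _) (.add (.get (.tail .id _) _ _) (.var _ _))))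
      (.ex (.eq (.get (.tail .id _) _ _) (.add (.get (.tail .id _) _ _) (.succ (.var _ _)))))
  have := hD.induction (Γ := Γ) (.cons y Sub.vars)
  simp only [Sub.cons_zero, Sub.cons_succ] at this
  refine this (or_inl (ex_intro y (eq_symm (Om.eq_zero_add Γ y)))) (fun x Δ _ ih => ?_) x
  refine or_elim ih (fun Δ _ h => ex_elim h fun d Δ _ h => ?_)
    (fun Δ _ h => ex_elim h fun d Δ _ h => ?_)
  · refine or_elim (zero_or_succ Δ d) (fun Δ s hd => ?_)
      (fun Δ s hd => ex_elim hd fun e Δ s' hd => ?_)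
    · refine or_inr (ex_intro .zero (cls_eq.1 ?_))
      have h₁ := cls_eq.2 ((Om.eq _ _).mono s h)
      have h₂ := cls_eq.2 hd
      simp only [cls_succ, cls_add, cls_zero] at h₁ h₂ ⊢
      rw [h₁, h₂]
      ring
    · refine or_inl (ex_intro e (cls_eq.1 ?_))
      have h₁ := cls_eq.2 ((Om.eq _ _).mono s' ((Om.eq _ _).mono s h))
      have h₂ := cls_eq.2 hd
      simp only [cls_succ, cls_add] at h₁ h₂ ⊢
      rw [h₁, h₂]
      ring
  · refine or_inr (ex_intro (.succ d) (cls_eq.1 ?_))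
    have h₁ := cls_eq.2 h
    simp only [cls_succ, cls_add] at h₁ ⊢
    rw [h₁]
    ring

/-- The codes of pairs with sum `s` lie between `s²` and `s² + s`, hence below `(s + 1)²`: a larger
sum gives a larger code. -/
theorem pair_ne_of_lt {Γ : List (Fml L)} {x y x' y' d : Tm L 0}
    (h : Om.eq (pair x y) (pair x' y') Γ)
    (h' : Om.eq (.add x' y') (.add (.add x y) (.succ d)) Γ) : Om.bot Γ := by
  have h := cls_eq.2 h
  have h' := cls_eq.2 h'
  simp only [pair, cls_add, cls_mul, cls_succ] at h h'
  generalize cls Γ x = x, cls Γ y = y, cls Γ x' = x', cls Γ y' = y', cls Γ d = d at h h'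
  rw [h'] at h
  -- The second code is written as the first plus a successor, so that two cancellations leave `0`
  -- equal to a successor.
  have : (x + y) * (x + y) + x = (x + y) * (x + y) +
      (x + ((x + 2 * y + 2 * (x + y) * d + 2 * d + d * d + x') + 1)) := h.trans (by ring)
  have := add_left_cancel (z := x + ((x + 2 * y + 2 * (x + y) * d + 2 * d + d * d + x') + 1)) this
  have := add_left_cancel ((add_zero x).trans this)
  exact add_one_ne_zero this.symm

/-- By `pair_ne_of_lt`, used in both directions, the sums agree. Cancelling their squares gives the
first components, and cancelling these in the sums gives the second. -/
theorem pair_inj {Γ : List (Fml L)} {x y x' y' : Tm L 0}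
    (h : Om.eq (pair x y) (pair x' y') Γ) : ((Om.eq x x').and (Om.eq y y')) Γ := by
  refine or_elim (le_or_lt Γ (.add x y) (.add x' y')) (fun Δ s hd => ?_) fun Δ s hd =>
    ex_elim hd fun d Δ s' hd => bot_elim (pair_ne_of_lt (eq_symm ?_) hd)
  · refine ex_elim hd fun d Δ s' hd => or_elim (zero_or_succ Δ d) (fun Δ s'' h₀ => ?_)
      fun Δ s'' h₁ => ex_elim h₁ fun e Δ s''' h₁ => bot_elim (pair_ne_of_lt (d := e)
        ((Om.eq _ _).mono (List.Subset.trans s (List.Subset.trans s'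
          (List.Subset.trans s'' s'''))) h) ?_)
    · have h := cls_eq.2 ((Om.eq _ _).mono (List.Subset.trans s (List.Subset.trans s' s'')) h)
      have hd := cls_eq.2 ((Om.eq _ _).mono s'' hd)
      have h₀ := cls_eq.2 h₀
      simp only [pair, cls_add, cls_mul, cls_zero] at h hd h₀
      rw [h₀, add_zero] at hd
      rw [hd] at h
      have hx := add_left_cancel h
      rw [hx] at hd
      exact ⟨cls_eq.1 hx, cls_eq.1 (add_left_cancel hd).symm⟩
    · have hd := cls_eq.2 ((Om.eq _ _).mono (List.Subset.trans s'' s''') hd)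
      have h₁ := cls_eq.2 h₁
      refine cls_eq.1 ?_
      simp only [cls_add, cls_succ] at hd h₁ ⊢
      rw [hd, h₁]
  · exact (Om.eq _ _).mono (List.Subset.trans s s') h

theorem numeral_ne {Γ : List (Fml L)} {m n : ℕ} (hmn : m ≠ n)
    (h : Om.eq (numeral m) (numeral n : Tm L 0) Γ) : Om.bot Γ := by
  induction m generalizing n with
  | zero =>
    cases n with
    | zero => exact absurd rfl hmn
    | succ n => exact succ_ne_zero (eq_symm h)
  | succ m ih =>
    cases n with
    | zero => exact succ_ne_zero h
    | succ n => exact ih (fun h => hmn (congrArg _ h)) (succ_inj h)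

theorem code_ne {Γ : List (Fml L)} {t t' : ℕ} (ht : t ≠ t') {x y x' y' : Tm L 0}
    (h : Om.eq (code t x y) (code t' x' y') Γ) : Om.bot Γ :=
  numeral_ne ht (pair_inj h).1

theorem code_inj {Γ : List (Fml L)} {t : ℕ} {x y x' y' : Tm L 0}
    (h : Om.eq (code t x y) (code t x' y') Γ) : ((Om.eq x x').and (Om.eq y y')) Γ :=
  pair_inj (pair_inj h).2

end Om

namespace Om

/-! ### An inductively defined partial application -/

/-- The value of `(a b) (c d)` is `w`, where application is given by its graph `X`. -/
def Comp (X : Tm L 0 → Tm L 0 → Tm L 0 → Om L) (a b c d w : Tm L 0) : Om L :=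
  Om.ex fun u : Tm L 0 => Om.ex fun v : Tm L 0 => (X a b u).and ((X c d v).and (X u v w))

/-- What it takes for the value of the combinator with the tag `t` and the arguments `x, y`,
applied to `z`, to be `w`.  The tags stand for `k`, `k x`, `s`, `s x`, `s x y`, `suc`, `rec`,
`rec x`, `rec x y`. -/
def Rule (X : Tm L 0 → Tm L 0 → Tm L 0 → Om L) (x y z w : Tm L 0) : Fin 9 → Om L
  | 0 => Om.eq w (code 1 z .zero)
  | 1 => Om.eq w x
  | 2 => Om.eq w (code 3 z .zero)
  | 3 => Om.eq w (code 4 x z)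
  | 4 => Comp X x z y z w
  | 5 => Om.eq w (.succ z)
  | 6 => Om.eq w (code 7 z .zero)
  | 7 => Om.eq w (code 8 x z)
  | 8 => ((Om.eq z .zero).and (Om.eq w x)).or
      (Om.ex fun z' : Tm L 0 => (Om.eq z (.succ z')).and (Comp X y z' (code 8 x y) z' w))

/-- The ternary relation coded by a set. -/
def memT (X : Tm L 1) (a z w : Tm L 0) : Om L := Om.mem (pair a (pair z w)) X

/-- A ternary relation is closed under the rules. -/
def Closed (X : Tm L 0 → Tm L 0 → Tm L 0 → Om L) : Om L :=
  Om.all fun t : Fin 9 => Om.all fun x : Tm L 0 => Om.all fun y : Tm L 0 =>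
    Om.all fun z : Tm L 0 => Om.all fun w : Tm L 0 =>
      (Rule X x y z w t).imp (X (code t x y) z w)

/-- The graph of application: the least relation that is closed under the rules. -/
def App (a z w : Tm L 0) : Om L :=
  Om.all fun X : Tm L 1 => (Closed (memT X)).imp (memT X a z w)

/-- A ternary relation that depends on a valuation is definable. -/
def DR (X : Sub L → Tm L 0 → Tm L 0 → Tm L 0 → Om L) : Prop :=
  ∀ {r : Sub L → Sub L} {a z w : Sub L → Tm L 0}, DS r → DT a → DT z → DT w →
    D fun ρ => X (r ρ) (a ρ) (z ρ) (w ρ)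

theorem DR.memT : DR fun ρ : Sub L => memT (ρ 1 0) := fun hr ha hz hw =>
  .mem (.pair ha (.pair hz hw)) (.get hr 1 0)

variable {Γ : List (Fml L)}

theorem DR.resp {Φ : Tm L 0 → Tm L 0 → Tm L 0 → Om L} (hΦ : DR fun _ => Φ)
    {a a' z z' w w' : Tm L 0} (ha : Om.eq a a' Γ) (hz : Om.eq z z' Γ) (hw : Om.eq w w' Γ)
    (h : Φ a z w Γ) : Φ a' z' w' Γ := by
  have h₁ : Φ a' z w Γ := by
    have := (hΦ .id (.var 0 0) (.var 0 1) (.var 0 2)).resp (.cons z (.cons w Sub.vars)) ha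
    exact this h
  have h₂ : Φ a' z' w Γ := by
    have := (hΦ .id (.var 0 1) (.var 0 0) (.var 0 2)).resp (.cons a' (.cons w Sub.vars)) hz
    exact this h₁
  have := (hΦ .id (.var 0 1) (.var 0 2) (.var 0 0)).resp (.cons a' (.cons z' Sub.vars)) hw
  exact this h₂

/-! ### Closure, induction and inversion for the graph of application -/

theorem comp_mono {X Y : Tm L 0 → Tm L 0 → Tm L 0 → Om L}
    (h : ∀ a z w Δ, Γ ⊆ Δ → X a z w Δ → Y a z w Δ) {a b c d w : Tm L 0}
    (hX : Comp X a b c d w Γ) : Comp Y a b c d w Γ :=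
  ex_elim hX fun u _ s hX => ex_elim hX fun v _ s' hX =>
    have s := List.Subset.trans s s'
    ex_intro u (ex_intro v ⟨h _ _ _ _ s hX.1, h _ _ _ _ s hX.2.1, h _ _ _ _ s hX.2.2⟩)

/-- The relation occurs only positively in the rules, which is what makes the intersection of all
closed relations closed. -/
theorem rule_mono {X Y : Tm L 0 → Tm L 0 → Tm L 0 → Om L}
    (h : ∀ a z w Δ, Γ ⊆ Δ → X a z w Δ → Y a z w Δ) {x y z w : Tm L 0} :
    ∀ t, Rule X x y z w t Γ → Rule Y x y z w t Γ
  | 0 | 1 | 2 | 3 | 5 | 6 | 7 => fun hX => hX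
  | 4 => fun hX => comp_mono h hX
  | 8 => fun hX => or_elim hX (fun _ _ hX => or_inl hX) fun _ s hX => or_inr <|
      ex_elim hX fun z' _ s' hX => ex_intro z' ⟨hX.1, comp_mono
        (fun a z w Δ s'' => h a z w Δ (List.Subset.trans s (List.Subset.trans s' s''))) hX.2⟩

theorem app_intro {x y z w : Tm L 0} (t : Fin 9) (h : Rule App x y z w t Γ) :
    App (code t x y) z w Γ := fun X _ s hX =>
  imp_elim (hX t x y z w) <| rule_mono (X := App) (fun _ _ _ _ s' h' =>
    imp_elim (h' X) ((Closed _).mono s' hX)) t ((Rule _ _ _ _ _ _).mono s h)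

variable [NoApp L]

theorem DR.comp {X : Sub L → Tm L 0 → Tm L 0 → Tm L 0 → Om L} (hX : DR X) {r : Sub L → Sub L}
    {a b c d w : Sub L → Tm L 0} (hr : DS r) (ha : DT a) (hb : DT b) (hc : DT c) (hd : DT d)
    (hw : DT w) : D fun ρ => Comp (X (r ρ)) (a ρ) (b ρ) (c ρ) (d ρ) (w ρ) := by
  have hr := (hr.comp_tail 0).comp_tail 0
  have ht {g : Sub L → Tm L 0} (hg : DT g) := (hg.comp_tail 0).comp_tail 0
  have h₁ : DT fun ρ : Sub L => Sub.tail 0 ρ 0 0 := .get (.tail .id 0) 0 0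
  exact .ex (.ex (.and (hX hr (ht ha) (ht hb) h₁) (.and (hX hr (ht hc) (ht hd) (.var 0 0))
    (hX hr h₁ (.var 0 0) (ht hw)))))

theorem DR.rule {X : Sub L → Tm L 0 → Tm L 0 → Tm L 0 → Om L} (hX : DR X) {r : Sub L → Sub L}
    {x y z w : Sub L → Tm L 0} (hr : DS r) (hx : DT x) (hy : DT y) (hz : DT z) (hw : DT w) :
    ∀ t, D fun ρ => Rule (X (r ρ)) (x ρ) (y ρ) (z ρ) (w ρ) t
  | 0 => .eq hw (.code 1 hz .zero)
  | 1 => .eq hw hx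
  | 2 => .eq hw (.code 3 hz .zero)
  | 3 => .eq hw (.code 4 hx hz)
  | 4 => hX.comp hr hx hz hy hz hw
  | 5 => .eq hw (.succ hz)
  | 6 => .eq hw (.code 7 hz .zero)
  | 7 => .eq hw (.code 8 hx hz)
  | 8 => .or (.and (.eq hz .zero) (.eq hw hx)) (.ex (.and
      (.eq (hz.comp_tail 0) (.succ (.var 0 0)))
      (hX.comp (hr.comp_tail 0) (hy.comp_tail 0) (.var 0 0)
        (.code 8 (hx.comp_tail 0) (hy.comp_tail 0)) (.var 0 0) (hw.comp_tail 0))))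

theorem DR.closed {X : Sub L → Tm L 0 → Tm L 0 → Tm L 0 → Om L} (hX : DR X)
    {r : Sub L → Sub L} (hr : DS r) : D fun ρ => Closed (X (r ρ)) := by
  have hr := (((hr.comp_tail 0).comp_tail 0).comp_tail 0).comp_tail 0
  have h₁ : DT fun ρ : Sub L => Sub.tail 0 ρ 0 0 := .get (.tail .id 0) 0 0
  have h₂ : DT fun ρ : Sub L => Sub.tail 0 (Sub.tail 0 ρ) 0 0 := h₁.comp_tail 0
  have h₃ : DT fun ρ : Sub L => Sub.tail 0 (Sub.tail 0 (Sub.tail 0 ρ)) 0 0 := h₂.comp_tail 0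
  exact .all_finite fun t => .all (.all (.all (.all (.imp (hX.rule hr h₃ h₂ h₁ (.var 0 0) t)
    (hX hr (.code t h₃ h₂) h₁ (.var 0 0))))))

theorem DR.app : DR fun _ : Sub L => App := fun _ ha hz hw =>
  .all (n := 1) (.imp (DR.memT.closed (r := fun ρ => ρ) .id)
    (DR.memT .id (ha.comp_tail 1) (hz.comp_tail 1) (hw.comp_tail 1)))

/-- Comprehension yields the set of coded triples that satisfy both `App` and `Φ`. It is closed
under the rules, so minimality of `App` applies. Keeping `App` in the set provides it in the
induction hypothesis. -/
theorem app_induction {Φ : Tm L 0 → Tm L 0 → Tm L 0 → Om L} (hΦ : DR fun _ => Φ)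
    (h : ∀ Δ, Γ ⊆ Δ → ∀ t x y z w, Rule (fun a z w => (App a z w).and (Φ a z w)) x y z w t Δ →
      Φ (code t x y) z w Δ) {a z w : Tm L 0} (h' : App a z w Γ) : Φ a z w Γ := by
  have hD : D fun ρ : Sub L => Om.ex fun a : Tm L 0 => Om.ex fun z : Tm L 0 =>
      Om.ex fun w : Tm L 0 => (Om.eq (ρ 0 0) (pair a (pair z w))).and
        ((App a z w).and (Φ a z w)) := by
    have h₁ : DT fun ρ : Sub L => Sub.tail 0 ρ 0 0 := .get (.tail .id 0) 0 0
    have h₂ : DT fun ρ : Sub L => Sub.tail 0 (Sub.tail 0 ρ) 0 0 := h₁.comp_tail 0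
    have h₃ : DT fun ρ : Sub L => Sub.tail 0 (Sub.tail 0 (Sub.tail 0 ρ)) 0 0 := h₂.comp_tail 0
    exact .ex (.ex (.ex (.and (.eq h₃ (.pair h₂ (.pair h₁ (.var 0 0))))
      (.and (DR.app .id h₂ h₁ (.var 0 0)) (hΦ .id h₂ h₁ (.var 0 0))))))
  refine ex_elim (hD.comprehension 0 Sub.vars Γ) fun X Δ s hX => ?_
  simp only [Sub.cons_zero] at hX
  -- A member of `X` is the code of some triple with the property; by injectivity of the pairing it
  -- is the given triple.
  have key : ∀ a z w Θ, Δ ⊆ Θ →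
      (memT X a z w Θ ↔ (App a z w).and (Φ a z w) Θ) := fun a z w Θ s' => by
    refine ⟨fun hm => ?_, fun hm => ?_⟩
    · refine ex_elim ((hX (pair a (pair z w))).1 Θ s' hm) fun a' Λ _ hm =>
        ex_elim hm fun z' Λ _ hm => ex_elim hm fun w' Λ _ hm => ?_
      have h₁ := pair_inj hm.1
      have h₂ := pair_inj h₁.2
      exact ⟨DR.app.resp (eq_symm h₁.1) (eq_symm h₂.1) (eq_symm h₂.2) hm.2.1,
        hΦ.resp (eq_symm h₁.1) (eq_symm h₂.1) (eq_symm h₂.2) hm.2.2⟩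
    · exact (hX (pair a (pair z w))).2 Θ s'
        (ex_intro a (ex_intro z (ex_intro w ⟨eq_refl _ _, hm⟩)))
  refine ((key a z w Δ fun _ => id).1 (imp_elim (((App a z w).mono s h') X) ?_)).2
  intro t x y z w Θ s' hR
  have hR' := rule_mono (fun a z w Λ s'' hm => (key a z w Λ (List.Subset.trans s' s'')).1 hm)
    t hR
  exact (key _ _ _ Θ s').2 ⟨app_intro t (rule_mono (Y := App) (fun _ _ _ _ _ hm => And.left hm) t hR'),
    h Θ (List.Subset.trans s s') t x y z w hR'⟩

theorem rule_resp {x y x' y' z w : Tm L 0} {t : Fin 9} (hx : Om.eq x x' Γ)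
    (hy : Om.eq y y' Γ) (h : Rule App x y z w t Γ) : Rule App x' y' z w t Γ := by
  have h₁ : Rule App x' y z w t Γ := by
    have := (DR.app.rule .id (.var 0 0) (.var 0 1) (.var 0 2) (.var 0 3) t).resp
      (.cons y (.cons z (.cons w Sub.vars))) hx
    exact this h
  have := (DR.app.rule .id (.var 0 1) (.var 0 0) (.var 0 2) (.var 0 3) t).resp
    (.cons x' (.cons z (.cons w Sub.vars))) hy
  exact this h₁

/-- Induction for the claim about every presentation of `a` as a code: different tags are
contradictory, and equal tags force equal arguments. -/
theorem app_inv {x y z w : Tm L 0} (t : Fin 9) (h : App (code t x y) z w Γ) :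
    Rule App x y z w t Γ := by
  have hD : DR fun _ : Sub L => fun a z w => Om.all fun t : Fin 9 => Om.all fun x : Tm L 0 =>
      Om.all fun y : Tm L 0 => (Om.eq a (code t x y)).imp (Rule App x y z w t) := by
    intro r a z w _ ha hz hw
    have ht {g : Sub L → Tm L 0} (hg : DT g) := (hg.comp_tail 0).comp_tail 0
    have h₁ : DT fun ρ : Sub L => Sub.tail 0 ρ 0 0 := .get (.tail .id 0) 0 0
    exact .all_finite fun t => .all (.all (.imp (.eq (ht ha) (.code t h₁ (.var 0 0)))
      (DR.app.rule .id h₁ (.var 0 0) (ht hz) (ht hw) t)))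
  refine imp_elim (app_induction (Φ := fun a z w => Om.all fun t : Fin 9 =>
    Om.all fun x : Tm L 0 => Om.all fun y : Tm L 0 => (Om.eq a (code t x y)).imp
      (Rule App x y z w t)) hD (fun Δ s t x y z w hR => ?_) h t x y) (eq_refl _ _)
  intro t' x' y' Θ s' he
  by_cases ht : t = t'
  · subst ht
    have := code_inj he
    exact rule_resp this.1 this.2 <| (Rule _ _ _ _ _ _).mono s' <|
      rule_mono (Y := App) (fun _ _ _ _ _ hm => And.left hm) t hR
  · exact bot_elim (code_ne (fun h => ht (Fin.ext h)) he)

/-- The first premise carries the induction hypothesis of `app_functional`: each of the three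
applications involved has a unique value. -/
theorem comp_functional {a b c d w w' : Tm L 0}
    (h : Comp (fun a z w => (App a z w).and
      (Om.all fun w' : Tm L 0 => (App a z w').imp (Om.eq w w'))) a b c d w Γ)
    (h' : Comp App a b c d w' Γ) : Om.eq w w' Γ := by
  refine ex_elim h fun u Δ s h => ex_elim h fun v Δ s₁ h => ?_
  refine ex_elim ((Comp _ _ _ _ _ _).mono (List.Subset.trans s s₁) h') fun u' Θ s₂ h' =>
    ex_elim h' fun v' Θ s₃ h' => ?_
  have s := List.Subset.trans s₂ s₃
  refine h.2.2.2 w' Θ s (DR.app.resp (eq_symm ?_) (eq_symm ?_) (eq_refl _ _) h'.2.2)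
  · exact h.1.2 u' Θ s h'.1
  · exact h.2.1.2 v' Θ s h'.2.1

/-- Induction on the first membership and inversion of the second. The tag determines the rule, and
for `rec x y` the zero and successor cases exclude each other. -/
theorem app_functional {a z w w' : Tm L 0} (h : App a z w Γ) (h' : App a z w' Γ) :
    Om.eq w w' Γ := by
  have hD : DR fun _ : Sub L => fun a z w => Om.all fun w' : Tm L 0 =>
      (App a z w').imp (Om.eq w w') := fun _ ha hz hw =>
    .all (.imp (DR.app .id (ha.comp_tail 0) (hz.comp_tail 0) (.var 0 0))
      (.eq (hw.comp_tail 0) (.var 0 0)))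
  refine imp_elim (app_induction (Φ := fun a z w => Om.all fun w' : Tm L 0 =>
    (App a z w').imp (Om.eq w w')) hD (fun Δ s t x y z w hR w' Θ s' hA => ?_) h w') h'
  have hR' := app_inv t hA
  replace hR := (Rule _ _ _ _ _ _).mono s' hR
  match t, hR, hR' with
  | 0, hR, hR' | 1, hR, hR' | 2, hR, hR' | 3, hR, hR' | 5, hR, hR' | 6, hR, hR' | 7, hR, hR' =>
    exact eq_trans hR (eq_symm hR')
  | 4, hR, hR' => exact comp_functional hR hR'
  | 8, hR, hR' =>
    refine or_elim hR (fun Λ s hR => or_elim ((Rule _ _ _ _ _ _).mono s hR') ?_ ?_)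
      fun Λ s hR => ex_elim hR fun z₁ Λ s₁ hR =>
        or_elim ((Rule _ _ _ _ _ 8).mono (List.Subset.trans s s₁) hR') ?_ ?_
    · exact fun Λ s hR' => eq_trans ((Om.eq _ _).mono s hR.2) (eq_symm hR'.2)
    · exact fun Λ s hR' => ex_elim hR' fun z₂ Λ s' hR' => bot_elim <| succ_ne_zero <|
        eq_trans (eq_symm hR'.1) ((Om.eq _ _).mono (List.Subset.trans s s') hR.1)
    · exact fun Λ s hR' => bot_elim <| succ_ne_zero <|
        eq_trans (eq_symm ((Om.eq _ _).mono s hR.1)) hR'.1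
    · refine fun Λ s hR' => ex_elim hR' fun z₂ Λ s' hR' => ?_
      replace hR := (Om.and _ _).mono (List.Subset.trans s s') hR
      have hz := succ_inj (eq_trans (eq_symm hR.1) hR'.1)
      refine comp_functional hR.2 ?_
      refine ex_elim hR'.2 fun u Λ s₂ hu => ex_elim hu fun v Λ s₃ hu => ?_
      have hz := eq_symm ((Om.eq _ _).mono (List.Subset.trans s₂ s₃) hz)
      exact ex_intro u (ex_intro v ⟨DR.app.resp (eq_refl _ _) hz (eq_refl _ _) hu.1,
        DR.app.resp (eq_refl _ _) hz (eq_refl _ _) hu.2.1, hu.2.2⟩)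

end Om

namespace Om

/-! ### Equivalence of truth values -/

variable {Γ : List (Fml L)} {φ ψ φ' ψ' : Om L}

theorem iff_intro (h : ∀ Δ, Γ ⊆ Δ → (φ Δ ↔ ψ Δ)) : (φ.iff ψ) Γ :=
  ⟨fun Δ s => (h Δ s).1, fun Δ s => (h Δ s).2⟩

theorem holds_iff (h : (φ.iff ψ) Γ) : φ Γ ↔ ψ Γ := ⟨iff_mp h, iff_mpr h⟩

theorem holds_iff_of_subset (h : (φ.iff ψ) Γ) {Δ : List (Fml L)} (s : Γ ⊆ Δ) : φ Δ ↔ ψ Δ :=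
  holds_iff ((Om.iff φ ψ).mono s h)

theorem iff_refl (φ : Om L) : (φ.iff φ) Γ := iff_intro fun _ _ => Iff.rfl

theorem iff_symm (h : (φ.iff ψ) Γ) : (ψ.iff φ) Γ := ⟨h.2, h.1⟩

theorem iff_trans {χ : Om L} (h : (φ.iff ψ) Γ) (h' : (ψ.iff χ) Γ) : (φ.iff χ) Γ :=
  iff_intro fun _ s => (holds_iff_of_subset h s).trans (holds_iff_of_subset h' s)

theorem and_congr (h : (φ.iff ψ) Γ) (h' : (φ'.iff ψ') Γ) :
    ((φ.and φ').iff (ψ.and ψ')) Γ :=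
  iff_intro fun _ s => _root_.and_congr (holds_iff_of_subset h s) (holds_iff_of_subset h' s)

theorem imp_congr (h : (φ.iff ψ) Γ) (h' : (φ'.iff ψ') Γ) :
    ((φ.imp φ').iff (ψ.imp ψ')) Γ :=
  iff_intro fun _ s => forall_congr' fun _ => forall_congr' fun s' => _root_.imp_congr
    (holds_iff_of_subset h (List.Subset.trans s s'))
    (holds_iff_of_subset h' (List.Subset.trans s s'))

theorem all_congr {ι : Type} {φ ψ : ι → Om L} (h : ∀ i, ((φ i).iff (ψ i)) Γ) :
    ((Om.all φ).iff (Om.all ψ)) Γ :=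
  iff_intro fun _ s => forall_congr' fun i => holds_iff_of_subset (h i) s

theorem ex_congr {ι : Type} {φ ψ : ι → Om L} (h : ∀ i, ((φ i).iff (ψ i)) Γ) :
    ((Om.ex φ).iff (Om.ex ψ)) Γ :=
  iff_intro fun _ s =>
    ⟨fun d => ex_elim d fun i _ s' e =>
      ex_intro i ((holds_iff_of_subset (h i) (List.Subset.trans s s')).1 e),
    fun d => ex_elim d fun i _ s' e =>
      ex_intro i ((holds_iff_of_subset (h i) (List.Subset.trans s s')).2 e)⟩

theorem or_congr (h : (φ.iff ψ) Γ) (h' : (φ'.iff ψ') Γ) : ((φ.or φ').iff (ψ.or ψ')) Γ :=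
  ex_congr fun b => match b with
    | true => h
    | false => h'

/-! ### Interpretation of HAHP -/

/-- The truth value of "the value of the term is `z`". -/
def val (ρ : Sub L) : {n : ℕ} → Tm .hahp n → Tm L n → Om L
  | _, .var n i, z => Om.eq (ρ n i) z
  | _, .zero, z => Om.eq .zero z
  | _, .succ a, z => Om.ex fun x : Tm L 0 => (val ρ a x).and (Om.eq (.succ x) z)
  | _, .add a b, z => Om.ex fun x : Tm L 0 => Om.ex fun y : Tm L 0 =>
      (val ρ a x).and ((val ρ b y).and (Om.eq (.add x y) z))
  | _, .mul a b, z => Om.ex fun x : Tm L 0 => Om.ex fun y : Tm L 0 =>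
      (val ρ a x).and ((val ρ b y).and (Om.eq (.mul x y) z))
  | _, .app _ a b, z => Om.ex fun x : Tm L 0 => Om.ex fun y : Tm L 0 =>
      (val ρ a x).and ((val ρ b y).and (App x y z))
  | _, .cK _, z => Om.eq (code 0 .zero .zero) z
  | _, .cS _, z => Om.eq (code 2 .zero .zero) z
  | _, .cSuc _, z => Om.eq (code 5 .zero .zero) z
  | _, .cRec _, z => Om.eq (code 6 .zero .zero) z

/-- The truth value of a formula of HAHP. -/
def sem : Fml .hahp → Sub L → Om L
  | .eq (n := n) a b, ρ => Om.ex fun z : Tm L n => (val ρ a z).and (val ρ b z)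
  | .mem (n := n) a b, ρ => Om.ex fun x : Tm L n => Om.ex fun y : Tm L (n + 1) =>
      (val ρ a x).and ((val ρ b y).and (Om.mem x y))
  | .den (n := n) _ a, ρ => Om.ex fun z : Tm L n => val ρ a z
  | .bot, _ => Om.bot
  | .top, _ => Om.top
  | .or A B, ρ => (sem A ρ).or (sem B ρ)
  | .and A B, ρ => (sem A ρ).and (sem B ρ)
  | .imp A B, ρ => (sem A ρ).imp (sem B ρ)
  | .ex n B, ρ => Om.ex fun z : Tm L n => sem B (Sub.cons z ρ)
  | .all n B, ρ => Om.all fun z : Tm L n => sem B (Sub.cons z ρ)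

/-! ### Values of terms, and substitution in the interpretation -/

theorem val_shift (m : ℕ) (ρ : Sub L) {n : ℕ} (a : Tm .hahp n) (z : Tm L n) :
    val ρ (a.subst (Sub.shift m)) z = val (Sub.tail m ρ) a z := by
  induction a with
  | var n i =>
    by_cases h : n = m
    · subst h
      simp [Tm.subst, Sub.shift, val]
    · simp [Tm.subst, Sub.shift, val, h, Sub.tail_of_ne h]
  | zero | cK | cS | cSuc | cRec => rfl
  | succ a ih => simp only [Tm.subst, val, ih]
  | add a b ih₁ ih₂ | mul a b ih₁ ih₂ | app _ a b ih₁ ih₂ => simp only [Tm.subst, val, ih₁, ih₂]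

theorem sem_simeq (h : Lang.hahp.Partial) {n : ℕ} {ρ : Sub L} {a b : Tm .hahp n}
    (hab : ∀ w, ((val ρ a w).iff (val ρ b w)) Γ) : sem (.simeq h a b) ρ Γ := fun _ s d =>
  or_elim d
    (fun _ s' d => ex_elim d fun w _ s'' d => ex_intro w
      ⟨d, (holds_iff_of_subset (hab w) (List.Subset.trans s (List.Subset.trans s' s''))).1 d⟩)
    fun _ s' d => ex_elim d fun w _ s'' d => ex_intro w
      ⟨(holds_iff_of_subset (hab w) (List.Subset.trans s (List.Subset.trans s' s''))).2 d, d⟩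

variable [NoApp L]

theorem D.val {n : ℕ} (a : Tm .hahp n) : ∀ {r : Sub L → Sub L} {g : Sub L → Tm L n},
    DS r → DT g → D fun ρ => val (r ρ) a (g ρ) := by
  have h₁ : DT fun ρ : Sub L => Sub.tail 0 ρ 0 0 := .get (.tail .id 0) 0 0
  induction a with
  | var n i => exact fun hr hg => .eq (.get hr n i) hg
  | zero => exact fun hr hg => .eq .zero hg
  | succ a ih =>
    exact fun hr hg => .ex (.and (ih (hr.comp_tail 0) (.var 0 0))
      (.eq (.succ (.var 0 0)) (hg.comp_tail 0)))
  | add a b ih₁ ih₂ =>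
    exact fun hr hg => .ex (.ex (.and (ih₁ ((hr.comp_tail 0).comp_tail 0) h₁)
      (.and (ih₂ ((hr.comp_tail 0).comp_tail 0) (.var 0 0))
        (.eq (.add h₁ (.var 0 0)) ((hg.comp_tail 0).comp_tail 0)))))
  | mul a b ih₁ ih₂ =>
    exact fun hr hg => .ex (.ex (.and (ih₁ ((hr.comp_tail 0).comp_tail 0) h₁)
      (.and (ih₂ ((hr.comp_tail 0).comp_tail 0) (.var 0 0))
        (.eq (.mul h₁ (.var 0 0)) ((hg.comp_tail 0).comp_tail 0)))))
  | app _ a b ih₁ ih₂ =>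
    exact fun hr hg => .ex (.ex (.and (ih₁ ((hr.comp_tail 0).comp_tail 0) h₁)
      (.and (ih₂ ((hr.comp_tail 0).comp_tail 0) (.var 0 0))
        (DR.app .id h₁ (.var 0 0) ((hg.comp_tail 0).comp_tail 0)))))
  | cK => exact fun _ hg => .eq (.code 0 .zero .zero) hg
  | cS => exact fun _ hg => .eq (.code 2 .zero .zero) hg
  | cSuc => exact fun _ hg => .eq (.code 5 .zero .zero) hg
  | cRec => exact fun _ hg => .eq (.code 6 .zero .zero) hg

theorem D.sem (A : Fml .hahp) : ∀ {r : Sub L → Sub L}, DS r → D fun ρ => sem A (r ρ) := by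
  induction A with
  | @eq n a b =>
    exact fun hr => .ex (.and (.val a (hr.comp_tail n) (.var n 0))
      (.val b (hr.comp_tail n) (.var n 0)))
  | @mem n a b =>
    exact fun hr => .ex (.ex (.and
      (.val a ((hr.comp_tail n).comp_tail (n + 1)) (.get (.tail .id _) n 0))
      (.and (.val b ((hr.comp_tail n).comp_tail (n + 1)) (.var _ 0))
        (.mem (.get (.tail .id _) n 0) (.var _ 0)))))
  | @den _ n a => exact fun hr => .ex (.val a (hr.comp_tail n) (.var n 0))
  | bot => exact fun _ => .bot
  | top => exact fun _ => .top
  | or A B ih₁ ih₂ => exact fun hr => .or (ih₁ hr) (ih₂ hr)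
  | and A B ih₁ ih₂ => exact fun hr => .and (ih₁ hr) (ih₂ hr)
  | imp A B ih₁ ih₂ => exact fun hr => .imp (ih₁ hr) (ih₂ hr)
  | ex n B ih => exact fun hr => .ex (ih (.cons (.var n 0) (hr.comp_tail n)))
  | all n B ih => exact fun hr => .all (ih (.cons (.var n 0) (hr.comp_tail n)))

theorem val_resp {ρ : Sub L} {n : ℕ} {a : Tm .hahp n} {z z' : Tm L n} (h : val ρ a z Γ)
    (hz : Om.eq z z' Γ) : val ρ a z' Γ := by
  have := (D.val a (DS.id.tail n) (.var n 0)).resp (Γ := Γ) (a := z) (b := z') ρ hz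
  simp only [Sub.cons_zero, Sub.tail_cons] at this
  exact this h

theorem val_functional {ρ : Sub L} {n : ℕ} {a : Tm .hahp n} {z z' : Tm L n}
    (h : val ρ a z Γ) (h' : val ρ a z' Γ) : Om.eq z z' Γ := by
  -- The common argument for `add`, `mul` and `app`: `X` is the graph of the operation, definable
  -- and single-valued.
  have key (g : Sub L → Tm L 0) (hg : DT g) {a b : Tm .hahp 0} {z z' : Tm L 0}
      (ih₁ : ∀ {Γ : List (Fml L)} {z z' : Tm L 0}, val ρ a z Γ → val ρ a z' Γ → Om.eq z z' Γ)
      (ih₂ : ∀ {Γ : List (Fml L)} {z z' : Tm L 0}, val ρ b z Γ → val ρ b z' Γ → Om.eq z z' Γ)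
      (X : Tm L 0 → Tm L 0 → Tm L 0 → Om L) (hX : DR fun _ => X)
      (hf : ∀ {Γ : List (Fml L)} {x y z z' : Tm L 0}, X x y z Γ → X x y z' Γ → Om.eq z z' Γ)
      {Γ : List (Fml L)}
      (h : Om.ex (fun x : Tm L 0 => Om.ex fun y : Tm L 0 =>
        (val ρ a x).and ((val ρ b y).and (X x y z))) Γ)
      (h' : Om.ex (fun x : Tm L 0 => Om.ex fun y : Tm L 0 =>
        (val ρ a x).and ((val ρ b y).and (X x y z'))) Γ) : Om.eq z z' Γ := by
    refine ex_elim h fun x Δ s h => ex_elim h fun y Δ s₁ h => ?_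
    refine ex_elim ((Om.ex _).mono (List.Subset.trans s s₁) h') fun x' Δ s₂ h' =>
      ex_elim h' fun y' Δ s₃ h' => ?_
    replace h := (Om.and _ _).mono (List.Subset.trans s₂ s₃) h
    exact hf (hX.resp (ih₁ h.1 h'.1) (ih₂ h.2.1 h'.2.1) (eq_refl _ _) h.2.2) h'.2.2
  induction a generalizing Γ with
  | var | zero | cK | cS | cSuc | cRec => exact eq_trans (eq_symm h) h'
  | succ a ih =>
    refine ex_elim h fun x Δ s h => ?_
    refine ex_elim ((Om.ex _).mono s h') fun x' Δ s₂ h' => ?_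
    replace h := (Om.and _ _).mono s₂ h
    have := eq_congr (DT.succ (.var 0 0)) Sub.vars (ih h.1 h'.1)
    exact eq_trans (eq_symm h.2) (eq_trans this h'.2)
  | add a b ih₁ ih₂ =>
    exact key (fun ρ => .add (ρ 0 0) (ρ 0 1)) (.add (.var _ _) (.var _ _)) ih₁ ih₂
      (fun x y z => Om.eq (.add x y) z) (fun _ ha hb hc => .eq (.add ha hb) hc)
      (fun h h' => eq_trans (eq_symm h) h') h h'
  | mul a b ih₁ ih₂ =>
    exact key (fun ρ => .mul (ρ 0 0) (ρ 0 1)) (.mul (.var _ _) (.var _ _)) ih₁ ih₂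
      (fun x y z => Om.eq (.mul x y) z) (fun _ ha hb hc => .eq (.mul ha hb) hc)
      (fun h h' => eq_trans (eq_symm h) h') h h'
  | app _ a b ih₁ ih₂ =>
    exact key (fun ρ => ρ 0 0) (.var _ _) ih₁ ih₂ App DR.app app_functional h h'

/-- Only substitutions whose terms all have values over `Γ` are covered. This matches the
definedness premises of the logic of partial terms. -/
theorem val_subst {σ : Sub .hahp} {ρ ρ' : Sub L} (h : ∀ n i, val ρ (σ n i) (ρ' n i) Γ) {n : ℕ}
    (a : Tm .hahp n) (z : Tm L n) : ((val ρ (a.subst σ) z).iff (val ρ' a z)) Γ := by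
  induction a with
  | var n i =>
    exact iff_intro fun Δ s => ⟨val_functional ((val _ _ _).mono s (h n i)),
      val_resp ((val _ _ _).mono s (h n i))⟩
  | zero | cK | cS | cSuc | cRec => exact iff_refl _
  | succ a ih => exact ex_congr fun x => and_congr (ih x) (iff_refl _)
  | add a b ih₁ ih₂ | mul a b ih₁ ih₂ | app _ a b ih₁ ih₂ =>
    exact ex_congr fun x => ex_congr fun y => and_congr (ih₁ x) (and_congr (ih₂ y) (iff_refl _))

theorem val_up {σ : Sub .hahp} {ρ ρ' : Sub L} (h : ∀ n i, val ρ (σ n i) (ρ' n i) Γ) {m : ℕ}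
    (z : Tm L m) (n i : ℕ) : val (Sub.cons z ρ) (Sub.up m σ n i) (Sub.cons z ρ' n i) Γ := by
  by_cases hn : n = m
  · subst hn
    cases i with
    | zero =>
      rw [Sub.up_zero, val, Sub.cons_zero, Sub.cons_zero]
      exact eq_refl _ _
    | succ i =>
      rw [Sub.up_succ, val_shift, Sub.cons_succ, Sub.tail_cons]
      exact h n i
  · rw [Sub.up_of_ne hn, val_shift, Sub.cons_of_ne hn, Sub.tail_cons]
    exact h n i

theorem sem_subst {σ : Sub .hahp} {ρ ρ' : Sub L} (h : ∀ n i, val ρ (σ n i) (ρ' n i) Γ)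
    (A : Fml .hahp) : ((sem (A.subst σ) ρ).iff (sem A ρ')) Γ := by
  induction A generalizing σ ρ ρ' with
  | eq a b => exact ex_congr fun x => and_congr (val_subst h a x) (val_subst h b x)
  | mem a b =>
    exact ex_congr fun x => ex_congr fun y =>
      and_congr (val_subst h a x) (and_congr (val_subst h b y) (iff_refl _))
  | den _ a => exact ex_congr fun x => val_subst h a x
  | bot | top => exact iff_refl _
  | or A B ih₁ ih₂ => exact or_congr (ih₁ h) (ih₂ h)
  | and A B ih₁ ih₂ => exact and_congr (ih₁ h) (ih₂ h)
  | imp A B ih₁ ih₂ => exact imp_congr (ih₁ h) (ih₂ h)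
  | ex n B ih => exact ex_congr fun z => ih (val_up h z)
  | all n B ih => exact all_congr fun z => ih (val_up h z)

theorem sem_shift (m : ℕ) (A : Fml .hahp) (ρ : Sub L) :
    sem (A.shift m) ρ = sem A (Sub.tail m ρ) :=
  ext_iff_holds fun Γ => holds_iff <| sem_subst (fun n i => by
    have := val_shift m ρ (.var n i) (Sub.tail m ρ n i)
    rw [Tm.subst] at this
    rw [this]
    exact eq_refl _ _) A

theorem sem_inst {m : ℕ} {a : Tm .hahp m} {ρ : Sub L} {z : Tm L m} (h : val ρ a z Γ)
    (B : Fml .hahp) : sem (B.inst a) ρ Γ ↔ sem B (Sub.cons z ρ) Γ := by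
  refine holds_iff (sem_subst (fun n i => ?_) B)
  rw [Sub.inst_eq_cons]
  by_cases hn : n = m
  · subst hn
    cases i with
    | zero =>
      rw [Sub.cons_zero, Sub.cons_zero]
      exact h
    | succ i =>
      rw [Sub.cons_succ, Sub.cons_succ]
      exact eq_refl _ _
  · rw [Sub.cons_of_ne hn, Sub.cons_of_ne hn]
    exact eq_refl _ _

/-! ### Terms and formulas of the smaller language -/

theorem ex_eq_and {n : ℕ} {f : Sub L → Om L} (hf : D f) (s : Tm L n) (ρ : Sub L) :
    (Om.ex fun z : Tm L n => (Om.eq s z).and (f (Sub.cons z ρ))) = f (Sub.cons s ρ) :=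
  ext_iff_holds fun _ => ⟨fun h => ex_elim h fun _ _ _ h => hf.resp ρ (eq_symm h.1) h.2,
    fun h => ex_intro s ⟨eq_refl _ _, h⟩⟩

theorem sem_eq_of_val {n : ℕ} {a b : Tm .hahp n} {s t : Tm L n} {ρ : Sub L}
    (ha : val ρ a = Om.eq s) (hb : val ρ b = Om.eq t) : sem (.eq a b) ρ = Om.eq s t := by
  rw [sem, ha, hb]
  exact ext_iff_holds fun _ => ⟨fun h => ex_elim h fun _ _ _ h => eq_trans h.1 (eq_symm h.2),
    fun h => ex_intro t ⟨h, eq_refl _ _⟩⟩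

theorem sem_mem_of_val {n : ℕ} {a : Tm .hahp n} {b : Tm .hahp (n + 1)} {s : Tm L n}
    {t : Tm L (n + 1)} {ρ : Sub L} (ha : val ρ a = Om.eq s) (hb : val ρ b = Om.eq t) :
    sem (.mem a b) ρ = Om.mem s t := by
  rw [sem, ha, hb]
  refine ext_iff_holds fun Γ => ⟨fun h => ex_elim h fun x Δ _ h => ex_elim h fun y Δ _ h => ?_,
    fun h => ex_intro s (ex_intro t ⟨eq_refl _ _, eq_refl _ _, h⟩)⟩
  have h₁ := (D.mem (.var n 0) (.var (n + 1) 0)).resp (.cons y Sub.vars) (eq_symm h.1)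
  simp only [Sub.cons_zero, Sub.cons_of_ne (Nat.succ_ne_self n)] at h₁
  have h₂ := (D.mem (.var n 0) (.var (n + 1) 0)).resp (.cons s Sub.vars) (eq_symm h.2.1)
  simp only [Sub.cons_zero, Sub.cons_of_ne (Nat.succ_ne_self n).symm] at h₂
  exact h₂ (h₁ h.2.2)

theorem sem_den_of_val (h : Lang.hahp.Partial) {n : ℕ} {a : Tm .hahp n} {s : Tm L n}
    {ρ : Sub L} (ha : val ρ a = Om.eq s) : sem (.den h a) ρ Γ := by
  rw [sem, ha]
  exact ex_intro s (eq_refl _ _)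

/-- Without `app`, every intermediate value is given by a term, and the existential quantifiers in
the graph collapse by the one-point rule. -/
theorem val_incl (i : L.HasApp → Lang.hahp.HasApp) (ρ : Sub L) {n : ℕ} (a : Tm L n) :
    val ρ (a.incl i) = Om.eq (a.subst ρ) := by
  have key {g : Tm L 0 → Tm L 0 → Tm L 0} (hg : DT fun ρ => g (ρ 0 0) (ρ 0 1)) {a b : Tm L 0}
      (ih₁ : val ρ (a.incl i) = Om.eq (a.subst ρ)) (ih₂ : val ρ (b.incl i) = Om.eq (b.subst ρ))
      (z : Tm L 0) : (Om.ex fun x : Tm L 0 => Om.ex fun y : Tm L 0 =>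
        (val ρ (a.incl i) x).and ((val ρ (b.incl i) y).and (Om.eq (g x y) z))) =
        Om.eq (g (a.subst ρ) (b.subst ρ)) z := by
    rw [ih₁, ih₂]
    refine ext_iff_holds fun Γ => ⟨fun h => ex_elim h fun x Δ _ h => ex_elim h fun y Δ _ h =>
      eq_trans ?_ h.2.2,
      fun h => ex_intro _ (ex_intro _ ⟨eq_refl _ _, eq_refl _ _, h⟩)⟩
    exact Number.eq_congr₂ hg h.1 h.2.1
  induction a with
  | var | zero => rfl
  | succ a ih =>
    funext z
    rw [Tm.incl, val, ih]
    have := ex_eq_and (D.eq (.succ (.var 0 0)) (.var 0 1)) (a.subst ρ) (.cons z Sub.vars)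
    exact this
  | add a b ih₁ ih₂ =>
    exact funext fun z => key (.add (.var _ _) (.var _ _)) ih₁ ih₂ z
  | mul a b ih₁ ih₂ =>
    exact funext fun z => key (.mul (.var _ _) (.var _ _)) ih₁ ih₂ z
  | app p | cK p | cS p | cSuc p | cRec p => exact absurd p NoApp.not_hasApp

/-- The interpretation leaves numbers, sets, equality and membership as they are; `ofFml` commutes
with the connectives and quantifiers, and definedness is true on both sides. -/
theorem sem_incl (i : L.HasApp → Lang.hahp.HasApp) (j : L.Partial → Lang.hahp.Partial)
    (A : Fml L) (ρ : Sub L) : sem (A.incl i j) ρ = ofFml (A.subst ρ) := by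
  induction A generalizing ρ with
  | eq a b => exact sem_eq_of_val (val_incl i ρ a) (val_incl i ρ b)
  | mem a b => exact sem_mem_of_val (val_incl i ρ a) (val_incl i ρ b)
  | den h a =>
    exact ext_iff_holds fun Γ => ⟨fun _ => Der.den_all Γ h _,
      fun _ => sem_den_of_val (j h) (val_incl i ρ a)⟩
  | bot => rfl
  | top => exact ofFml_top.symm
  | or A B ih₁ ih₂ => rw [Fml.incl, sem, ih₁, ih₂, Fml.subst, ofFml_or]
  | and A B ih₁ ih₂ => rw [Fml.incl, sem, ih₁, ih₂, Fml.subst, ofFml_and]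
  | imp A B ih₁ ih₂ => rw [Fml.incl, sem, ih₁, ih₂, Fml.subst, ofFml_imp]
  | ex n B ih => simp only [Fml.incl, sem, ih, Fml.subst, ofFml_ex, Fml.subst_up_inst]
  | all n B ih => simp only [Fml.incl, sem, ih, Fml.subst, ofFml_all, Fml.subst_up_inst]

/-! ### Application -/

theorem val_app (p : Lang.hahp.HasApp) {ρ : Sub L} {a b : Tm .hahp 0} {x y : Tm L 0}
    (ha : val ρ a x Γ) (hb : val ρ b y Γ) (z : Tm L 0) :
    ((val ρ (.app p a b) z).iff (App x y z)) Γ :=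
  iff_intro fun _ s => ⟨fun h => ex_elim h fun _ _ s' h => ex_elim h fun _ _ s'' h =>
      have s := List.Subset.trans s (List.Subset.trans s' s'')
      DR.app.resp (val_functional h.1 ((val _ _ _).mono s ha))
        (val_functional h.2.1 ((val _ _ _).mono s hb)) (eq_refl _ _) h.2.2,
    fun h => ex_intro x (ex_intro y ⟨(val _ _ _).mono s ha, (val _ _ _).mono s hb, h⟩)⟩

theorem app_code (t : Fin 9) (x y z w : Tm L 0) :
    ((App (code t x y) z w).iff (Rule App x y z w t)) Γ :=
  iff_intro fun _ _ => ⟨app_inv t, app_intro t⟩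

theorem val_app_code (t : Fin 9) (p : Lang.hahp.HasApp) {ρ : Sub L} {a b : Tm .hahp 0}
    {x y z : Tm L 0} (ha : val ρ a (code t x y) Γ) (hb : val ρ b z Γ) (w : Tm L 0) :
    ((val ρ (.app p a b) w).iff (Rule App x y z w t)) Γ :=
  iff_trans (val_app p ha hb w) (app_code t x y z w)

theorem val_app_app (p : Lang.hahp.HasApp) {ρ : Sub L} {a b c d : Tm .hahp 0}
    {x y z w : Tm L 0} (ha : val ρ a x Γ) (hb : val ρ b y Γ) (hc : val ρ c z Γ)
    (hd : val ρ d w Γ) (v : Tm L 0) :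
    ((val ρ (.app p (.app p a b) (.app p c d)) v).iff (Comp App x y z w v)) Γ :=
  ex_congr fun u => ex_congr fun u' =>
    and_congr (val_app p ha hb u) (and_congr (val_app p hc hd u') (iff_refl _))

/-- At a successor the zero case is contradictory, and injectivity of `succ` identifies the
predecessor with `z`. -/
theorem rule_succ (x y z w : Tm L 0) :
    ((Rule App x y (.succ z) w 8).iff (Comp App y z (code 8 x y) z w)) Γ := by
  refine iff_intro fun Δ _ => ⟨fun h => or_elim h
    (fun _ _ h => bot_elim (succ_ne_zero h.1)) fun _ _ h => ex_elim h fun z' Θ _ h => ?_,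
    fun h => or_inr (ex_intro z ⟨eq_refl _ _, h⟩)⟩
  have hz := eq_symm (succ_inj h.1)
  exact ex_elim h.2 fun u Θ s h => ex_elim h fun v Θ s' h =>
    have hz := (Om.eq _ _).mono (List.Subset.trans s s') hz
    ex_intro u (ex_intro v ⟨DR.app.resp (eq_refl _ _) hz (eq_refl _ _) h.1,
      DR.app.resp (eq_refl _ _) hz (eq_refl _ _) h.2.1, h.2.2⟩)

end Om

namespace Om

/-! ### Soundness of the interpretation -/

variable [NoApp L]

theorem sem_toHAHP (A : Fml L) (ρ : Sub L) : sem A.toHAHP ρ = ofFml (A.subst ρ) :=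
  sem_incl (fun _ => trivial) (fun _ => trivial) A ρ

theorem sem_toHAHP_of_ax {A : Fml L} (h : Ax L A) (ρ : Sub L) (Γ : List (Fml L)) :
    sem A.toHAHP ρ Γ := by
  rw [sem_toHAHP]
  exact Der.ax (h.subst ρ)

theorem val_var {Γ : List (Fml L)} {ρ : Sub L} {n i : ℕ} {z : Tm L n} (h : ρ n i = z) :
    val ρ (.var n i) z Γ :=
  h ▸ eq_refl Γ (ρ n i)

/-- Induction for formulas with `app` reduces to induction in HAH because their truth values are
definable there (`D.sem`); comprehension is treated likewise. -/
theorem sem_ind (A : Fml .hahp) (ρ : Sub L) (Γ : List (Fml L)) :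
    sem (.imp (.and (A.inst .zero) (.all 0 (.imp A (A.subst Sub.succ)))) (.all 0 A)) ρ Γ := by
  intro Δ _ h
  refine (D.sem A .id).induction ρ ((sem_inst (a := .zero) (eq_refl _ Tm.zero) A).1 h.1) fun x Θ s hx => ?_
  refine (holds_iff (sem_subst (σ := Sub.succ) (ρ := Sub.cons x ρ) (fun n i => ?_) A)).1
    (h.2 x Θ s hx)
  by_cases hn : n = 0
  · subst hn
    cases i with
    | zero => exact ex_intro x ⟨eq_refl _ _, eq_refl _ _⟩
    | succ i => exact eq_refl _ _
  · obtain ⟨n, rfl⟩ := Nat.exists_eq_succ_of_ne_zero hn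
    exact eq_refl _ _

theorem sem_compr (n : ℕ) (P : Fml .hahp) (ρ : Sub L) (Γ : List (Fml L)) :
    sem (.ex (n + 1) (.all n (.iff (.mem (.var n 0) (.var (n + 1) 0)) (P.shift (n + 1))))) ρ
      Γ := by
  refine ex_elim ((D.sem P .id).comprehension n ρ Γ) fun X Δ _ h => ex_intro X fun z => ?_
  have h₁ : sem (.mem (.var n 0) (.var (n + 1) 0)) (Sub.cons z (Sub.cons X ρ)) = Om.mem z X :=
    sem_mem_of_val (by funext w; simp [val])
      (by funext w; simp [val, Sub.cons_of_ne (Nat.succ_ne_self n)])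
  change ((sem _ _).iff (sem _ _)) Δ
  rw [h₁, sem_shift, Sub.tail_cons_of_ne (Nat.succ_ne_self n).symm, Sub.tail_cons]
  exact h z

theorem sem_ax {A : Fml .hahp} (h : Ax .hahp A) (ρ : Sub L) (Γ : List (Fml L)) :
    sem A ρ Γ := by
  cases h with
  | ext n => exact sem_toHAHP_of_ax (.ext n) ρ Γ
  | compr n P => exact sem_compr n P ρ Γ
  | succ_ne_zero => exact sem_toHAHP_of_ax .succ_ne_zero ρ Γ
  | succ_inj => exact sem_toHAHP_of_ax .succ_inj ρ Γ
  | zero_add => exact sem_toHAHP_of_ax .zero_add ρ Γ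
  | succ_add => exact sem_toHAHP_of_ax .succ_add ρ Γ
  | zero_mul => exact sem_toHAHP_of_ax .zero_mul ρ Γ
  | succ_mul => exact sem_toHAHP_of_ax .succ_mul ρ Γ
  | ind A => exact sem_ind A ρ Γ
  | zero_den | k_den | s_den | suc_den | rec_den => exact ex_intro _ (eq_refl _ _)
  | succ_den => exact fun x => ex_intro _ (ex_intro x ⟨eq_refl _ _, eq_refl _ _⟩)
  | add_den | mul_den =>
    exact fun x y => ex_intro _ (ex_intro x (ex_intro y ⟨eq_refl _ _, eq_refl _ _, eq_refl _ _⟩))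
  | k_app p =>
    intro x y
    have h₁ := (holds_iff (val_app_code (Γ := Γ) 0 p (ρ := Sub.cons y (Sub.cons x ρ))
      (a := .cK p) (b := .var 0 1) (eq_refl _ _) (val_var (z := x) rfl) _)).2 (eq_refl _ _)
    exact ex_intro x ⟨(holds_iff (val_app_code 1 p h₁ (val_var (z := y) rfl) _)).2
      (eq_refl _ _), eq_refl _ _⟩
  | s_app_den h p =>
    intro x y
    have h₁ := (holds_iff (val_app_code (Γ := Γ) 2 p (ρ := Sub.cons y (Sub.cons x ρ))
      (a := .cS p) (b := .var 0 1) (eq_refl _ _) (val_var (z := x) rfl) _)).2 (eq_refl _ _)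
    exact ex_intro _ ((holds_iff (val_app_code 3 p h₁ (val_var (z := y) rfl) _)).2 (eq_refl _ _))
  | s_app h p =>
    intro x y z
    have hx : val (Sub.cons z (Sub.cons y (Sub.cons x ρ))) (.var 0 2) x Γ := val_var rfl
    have hy : val (Sub.cons z (Sub.cons y (Sub.cons x ρ))) (.var 0 1) y Γ := val_var rfl
    have hz : val (Sub.cons z (Sub.cons y (Sub.cons x ρ))) (.var 0 0) z Γ := val_var rfl
    have h₁ := (holds_iff (val_app_code 2 p (a := .cS p) (eq_refl _ _) hx _)).2 (eq_refl _ _)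
    have h₂ := (holds_iff (val_app_code 3 p h₁ hy _)).2 (eq_refl _ _)
    -- `s x y` has the value `code 4 x y`, so both sides have the graph `Comp App x z y z`.
    exact sem_simeq h fun w => iff_trans (val_app_code 4 p h₂ hz w)
      (iff_symm (val_app_app p hx hz hy hz w))
  | suc_app p =>
    intro x
    have hx : val (Sub.cons x ρ) (.var 0 0) x Γ := val_var rfl
    exact ex_intro (.succ x)
      ⟨(holds_iff (val_app_code 5 p (a := .cSuc p) (eq_refl _ _) hx _)).2 (eq_refl _ _),
        ex_intro x ⟨hx, eq_refl _ _⟩⟩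
  | rec_zero p =>
    intro x y
    have hx : val (Sub.cons y (Sub.cons x ρ)) (.var 0 1) x Γ := val_var rfl
    have hy : val (Sub.cons y (Sub.cons x ρ)) (.var 0 0) y Γ := val_var rfl
    have h₁ := (holds_iff (val_app_code 6 p (a := .cRec p) (eq_refl _ _) hx _)).2 (eq_refl _ _)
    have h₂ := (holds_iff (val_app_code 7 p h₁ hy _)).2 (eq_refl _ _)
    exact ex_intro x ⟨(holds_iff (val_app_code 8 p h₂ (b := .zero) (eq_refl _ _) x)).2
      (or_inl ⟨eq_refl _ _, eq_refl _ _⟩), hx⟩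
  | rec_succ h p =>
    intro x y z
    have hx : val (Sub.cons z (Sub.cons y (Sub.cons x ρ))) (.var 0 2) x Γ := val_var rfl
    have hy : val (Sub.cons z (Sub.cons y (Sub.cons x ρ))) (.var 0 1) y Γ := val_var rfl
    have hz : val (Sub.cons z (Sub.cons y (Sub.cons x ρ))) (.var 0 0) z Γ := val_var rfl
    have h₁ := (holds_iff (val_app_code 6 p (a := .cRec p) (eq_refl _ _) hx _)).2 (eq_refl _ _)
    have h₂ := (holds_iff (val_app_code 7 p h₁ hy _)).2 (eq_refl _ _)
    have hs : val (Sub.cons z (Sub.cons y (Sub.cons x ρ))) (.succ (.var 0 0)) (.succ z) Γ :=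
      ex_intro z ⟨hz, eq_refl _ _⟩
    -- `rec x y` has the value `code 8 x y`, and the rule for a successor refers to this same code
    -- for the recursive call.
    exact sem_simeq h fun w => iff_trans (val_app_code 8 p h₂ hs w)
      (iff_trans (rule_succ x y z w) (iff_symm (val_app_app p hy hz h₂ hz w)))

/-- Induction on the derivation. The definedness premises of the quantifier rules supply the value
at which to instantiate, and the strictness rules hold because the graph of a compound expression
asserts values of its parts. -/
theorem sem_of_der {Γ' : List (Fml .hahp)} {A : Fml .hahp} (d : Der Γ' A) :
    ∀ (ρ : Sub L) (Γ : List (Fml L)), (∀ B ∈ Γ', sem B ρ Γ) → sem A ρ Γ := by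
  have cons_hyp {Γ' : List (Fml .hahp)} {A : Fml .hahp} {ρ : Sub L} {Γ Δ : List (Fml L)}
      (s : Γ ⊆ Δ) (h : ∀ B ∈ Γ', sem B ρ Γ) (hA : sem A ρ Δ) : ∀ B ∈ A :: Γ', sem B ρ Δ := by
    intro B hB
    rcases List.mem_cons.1 hB with rfl | hB
    · exact hA
    · exact (sem B ρ).mono s (h B hB)
  have shift_hyp {Γ' : List (Fml .hahp)} {ρ : Sub L} {Γ : List (Fml L)} {n : ℕ} (z : Tm L n)
      (h : ∀ B ∈ Γ', sem B ρ Γ) : ∀ B ∈ Γ'.map (Fml.shift n), sem B (Sub.cons z ρ) Γ := by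
    intro B hB
    obtain ⟨C, hC, rfl⟩ := List.mem_map.1 hB
    rw [sem_shift, Sub.tail_cons]
    exact h C hC
  induction d with
  | ax h => exact fun ρ Γ _ => sem_ax h ρ Γ
  | hyp h => exact fun ρ Γ hΓ => hΓ _ h
  | top_intro => exact fun _ _ _ => trivial
  | bot_elim _ ih => exact fun ρ Γ h => bot_elim (ih ρ Γ h)
  | and_intro _ _ ih₁ ih₂ => exact fun ρ Γ h => ⟨ih₁ ρ Γ h, ih₂ ρ Γ h⟩
  | and_left _ ih => exact fun ρ Γ h => (ih ρ Γ h).1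
  | and_right _ ih => exact fun ρ Γ h => (ih ρ Γ h).2
  | or_left _ ih => exact fun ρ Γ h => or_inl (ih ρ Γ h)
  | or_right _ ih => exact fun ρ Γ h => or_inr (ih ρ Γ h)
  | or_elim _ _ _ ih₁ ih₂ ih₃ =>
    exact fun ρ Γ h => or_elim (ih₁ ρ Γ h) (fun Δ s hA => ih₂ ρ Δ (cons_hyp s h hA))
      fun Δ s hB => ih₃ ρ Δ (cons_hyp s h hB)
  | imp_intro _ ih => exact fun ρ Γ h Δ s hA => ih ρ Δ (cons_hyp s h hA)
  | imp_elim _ _ ih₁ ih₂ => exact fun ρ Γ h => imp_elim (ih₁ ρ Γ h) (ih₂ ρ Γ h)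
  | all_intro _ ih => exact fun ρ Γ h z => ih _ Γ (shift_hyp z h)
  | all_elim a _ _ ih₁ ih₂ =>
    exact fun ρ Γ h => ex_elim (ih₂ trivial ρ Γ h) fun z Δ s hz =>
      (sem_inst hz _).2 ((sem _ _).mono s (ih₁ ρ Γ h z))
  | ex_intro a _ _ ih₁ ih₂ =>
    exact fun ρ Γ h => ex_elim (ih₂ trivial ρ Γ h) fun z Δ s hz =>
      ex_intro z ((sem_inst hz _).1 ((sem _ _).mono s (ih₁ ρ Γ h)))
  | @ex_elim Γ' n B C _ _ ih₁ ih₂ =>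
    intro ρ Γ h
    refine ex_elim (ih₁ ρ Γ h) fun z Δ s hz => ?_
    have := ih₂ (Sub.cons z ρ) Δ (cons_hyp s (shift_hyp z h) hz)
    rwa [sem_shift, Sub.tail_cons] at this
  | eq_refl a _ ih =>
    exact fun ρ Γ h => ex_elim (ih trivial ρ Γ h) fun z _ _ hz => ex_intro z ⟨hz, hz⟩
  -- Both terms have the common value `z`, so both instances of `B` are equivalent to `B` at `z`.
  | eq_subst B _ _ ih₁ ih₂ =>
    exact fun ρ Γ h => ex_elim (ih₁ ρ Γ h) fun z Δ s hz =>
      (sem_inst hz.2 B).2 ((sem_inst hz.1 B).1 ((sem _ _).mono s (ih₂ ρ Γ h)))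
  | den_var _ n i => exact fun ρ Γ _ => ex_intro _ (eq_refl _ _)
  | den_succ _ _ ih =>
    exact fun ρ Γ h => ex_elim (ih ρ Γ h) fun _ _ _ h => ex_elim h fun x _ _ h => ex_intro x h.1
  | den_add_left _ _ ih | den_mul_left _ _ ih | den_app_left _ _ _ ih =>
    exact fun ρ Γ h => ex_elim (ih ρ Γ h) fun _ _ _ h => ex_elim h fun x _ _ h =>
      ex_elim h fun _ _ _ h => ex_intro x h.1
  | den_add_right _ _ ih | den_mul_right _ _ ih | den_app_right _ _ _ ih =>
    exact fun ρ Γ h => ex_elim (ih ρ Γ h) fun _ _ _ h => ex_elim h fun _ _ _ h =>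
      ex_elim h fun y _ _ h => ex_intro y h.2.1
  | den_eq_left _ _ ih => exact fun ρ Γ h => ex_elim (ih ρ Γ h) fun x _ _ h => ex_intro x h.1
  | den_eq_right _ _ ih => exact fun ρ Γ h => ex_elim (ih ρ Γ h) fun x _ _ h => ex_intro x h.2
  | den_mem_left _ _ ih =>
    exact fun ρ Γ h => ex_elim (ih ρ Γ h) fun x _ _ h => ex_elim h fun _ _ _ h =>
      ex_intro x h.1
  | den_mem_right _ _ ih =>
    exact fun ρ Γ h => ex_elim (ih ρ Γ h) fun _ _ _ h => ex_elim h fun y _ _ h =>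
      ex_intro y h.2.1

end Om

/-! ### Inclusion of derivations -/

/-- A term as a term of HAHP. -/
def Tm.toHAHP {n : ℕ} (a : Tm L n) : Tm .hahp n :=
  a.incl (L' := .hahp) fun _ => trivial

/-- A substitution as a substitution of HAHP. -/
def Sub.toHAHP (σ : Sub L) : Sub .hahp := fun n i => (σ n i).toHAHP

theorem Tm.toHAHP_subst {n : ℕ} (a : Tm L n) (σ : Sub L) :
    (a.subst σ).toHAHP = a.toHAHP.subst σ.toHAHP := by
  unfold Tm.toHAHP
  induction a <;> simp_all [Tm.subst, Tm.incl, Sub.toHAHP, Tm.toHAHP]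

theorem Sub.toHAHP_shift (m : ℕ) : (Sub.shift m : Sub L).toHAHP = Sub.shift m := by
  funext n i
  simp only [Sub.toHAHP, Sub.shift]
  split_ifs <;> rfl

theorem Sub.toHAHP_cons {m : ℕ} (t : Tm L m) (σ : Sub L) :
    (Sub.cons t σ).toHAHP = Sub.cons t.toHAHP σ.toHAHP := by
  refine Sub.ext_sort m (by simp [Sub.toHAHP]) (fun i => by simp [Sub.toHAHP]) fun n h i => ?_
  simp only [Sub.toHAHP, Sub.cons_of_ne h]

theorem Sub.toHAHP_up (m : ℕ) (σ : Sub L) : (Sub.up m σ).toHAHP = Sub.up m σ.toHAHP := by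
  rw [Sub.up_eq_cons, Sub.up_eq_cons, Sub.toHAHP_cons]
  congr 1
  funext n i
  simp only [Sub.toHAHP, Sub.comp, Tm.toHAHP_subst, ← Sub.toHAHP_shift (L := L)]

theorem Fml.toHAHP_subst (A : Fml L) (σ : Sub L) :
    (A.subst σ).toHAHP = A.toHAHP.subst σ.toHAHP := by
  induction A generalizing σ with
  | eq a b =>
    exact congrArg₂ Fml.eq (Tm.toHAHP_subst a σ) (Tm.toHAHP_subst b σ)
  | mem a b => exact congrArg₂ Fml.mem (Tm.toHAHP_subst a σ) (Tm.toHAHP_subst b σ)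
  | den h a => exact congrArg (Fml.den _) (Tm.toHAHP_subst a σ)
  | bot | top => rfl
  | or A B ih₁ ih₂ => exact congrArg₂ Fml.or (ih₁ σ) (ih₂ σ)
  | and A B ih₁ ih₂ => exact congrArg₂ Fml.and (ih₁ σ) (ih₂ σ)
  | imp A B ih₁ ih₂ => exact congrArg₂ Fml.imp (ih₁ σ) (ih₂ σ)
  | ex n B ih => exact congrArg (Fml.ex n) ((ih _).trans (Sub.toHAHP_up n σ ▸ rfl))
  | all n B ih => exact congrArg (Fml.all n) ((ih _).trans (Sub.toHAHP_up n σ ▸ rfl))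

theorem Fml.toHAHP_shift (m : ℕ) (A : Fml L) : (A.shift m).toHAHP = A.toHAHP.shift m := by
  rw [Fml.shift, Fml.toHAHP_subst, Sub.toHAHP_shift, Fml.shift]

theorem Fml.toHAHP_inst {m : ℕ} (A : Fml L) (t : Tm L m) :
    (A.inst t).toHAHP = A.toHAHP.inst t.toHAHP := by
  rw [Fml.inst, Fml.toHAHP_subst, Sub.inst_eq_cons, Sub.toHAHP_cons]
  rfl

theorem Ax.toHAHP {A : Fml L} (h : Ax L A) : Ax .hahp A.toHAHP := by
  cases h with
  | ext n => exact .ext n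
  | compr n P =>
    have := Ax.compr n P.toHAHP
    rwa [← Fml.toHAHP_shift] at this
  | ind A =>
    have := Ax.ind A.toHAHP
    have e : (Sub.succ : Sub L).toHAHP = Sub.succ := by
      rw [Sub.succ_eq_cons, Sub.succ_eq_cons, Sub.toHAHP_cons]
      congr 1
      exact Sub.toHAHP_shift 0
    rw [← e, ← Fml.toHAHP_subst] at this
    have e' : (A.inst (.zero : Tm L 0)).toHAHP = A.toHAHP.inst .zero :=
      Fml.toHAHP_inst A (.zero : Tm L 0)
    rwa [← e'] at this
  | succ_ne_zero => exact .succ_ne_zero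
  | succ_inj => exact .succ_inj
  | zero_add => exact .zero_add
  | succ_add => exact .succ_add
  | zero_mul => exact .zero_mul
  | succ_mul => exact .succ_mul
  | zero_den => exact Ax.zero_den (L := .hahp) trivial
  | succ_den => exact Ax.succ_den (L := .hahp) trivial
  | add_den => exact Ax.add_den (L := .hahp) trivial
  | mul_den => exact Ax.mul_den (L := .hahp) trivial
  | k_den => exact Ax.k_den (L := .hahp) trivial trivial
  | s_den => exact Ax.s_den (L := .hahp) trivial trivial
  | suc_den => exact Ax.suc_den (L := .hahp) trivial trivial
  | rec_den => exact Ax.rec_den (L := .hahp) trivial trivial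
  | k_app => exact Ax.k_app (L := .hahp) trivial
  | s_app_den => exact Ax.s_app_den (L := .hahp) trivial trivial
  | s_app => exact Ax.s_app (L := .hahp) trivial trivial
  | suc_app => exact Ax.suc_app (L := .hahp) trivial
  | rec_zero => exact Ax.rec_zero (L := .hahp) trivial
  | rec_succ => exact Ax.rec_succ (L := .hahp) trivial trivial

/-- Derivations in ordinary logic carry no definedness premises; the totality axioms supply those
that HAHP demands. -/
theorem Der.den_toHAHP [NoApp L] (Γ : List (Fml .hahp)) (h : Lang.hahp.Partial) {n : ℕ}
    (a : Tm L n) : Der Γ (.den h a.toHAHP) := by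
  unfold Tm.toHAHP
  induction a with
  | var n i => exact .den_var h n i
  | zero => exact .ax (.zero_den h)
  | succ a ih => exact .den_succ_intro h ih
  | add a b ih₁ ih₂ => exact .den_add_intro h ih₁ ih₂
  | mul a b ih₁ ih₂ => exact .den_mul_intro h ih₁ ih₂
  | app p | cK p | cS p | cSuc p | cRec p => exact absurd p NoApp.not_hasApp

theorem Der.toHAHP [NoApp L] {Γ : List (Fml L)} {A : Fml L} (d : Der Γ A) :
    Der (Γ.map Fml.toHAHP) A.toHAHP := by
  have key : ∀ (Γ : List (Fml L)) (n : ℕ), (Γ.map (Fml.shift n)).map Fml.toHAHP =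
      (Γ.map Fml.toHAHP).map (Fml.shift n) := fun Γ n => by
    simp [Fml.toHAHP_shift]
  induction d with
  | ax h => exact .ax h.toHAHP
  | hyp h => exact .hyp (List.mem_map_of_mem h)
  | top_intro => exact .top_intro
  | bot_elim _ ih => exact .bot_elim ih
  | and_intro _ _ ih₁ ih₂ => exact .and_intro ih₁ ih₂
  | and_left _ ih => exact .and_left ih
  | and_right _ ih => exact .and_right ih
  | or_left _ ih => exact .or_left ih
  | or_right _ ih => exact .or_right ih
  | or_elim _ _ _ ih₁ ih₂ ih₃ => exact .or_elim ih₁ ih₂ ih₃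
  | imp_intro _ ih => exact .imp_intro ih
  | imp_elim _ _ ih₁ ih₂ => exact .imp_elim ih₁ ih₂
  | all_intro _ ih => exact .all_intro (key _ _ ▸ ih)
  | all_elim a _ _ ih₁ _ =>
    exact Fml.toHAHP_inst _ a ▸ .all_elim _ ih₁ fun h => .den_toHAHP _ h a
  | ex_intro a _ _ ih₁ _ =>
    exact .ex_intro _ (Fml.toHAHP_inst _ a ▸ ih₁) fun h => .den_toHAHP _ h a
  | ex_elim _ _ ih₁ ih₂ => exact .ex_elim ih₁ (key _ _ ▸ Fml.toHAHP_shift _ _ ▸ ih₂)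
  | eq_refl a _ _ => exact .eq_refl _ fun h => .den_toHAHP _ h a
  | @eq_subst _ _ a b B _ _ ih₁ ih₂ =>
    exact Fml.toHAHP_inst _ b ▸ .eq_subst _ ih₁ (Fml.toHAHP_inst _ a ▸ ih₂)
  | den_var | den_succ | den_add_left | den_add_right | den_mul_left | den_mul_right
  | den_app_left | den_app_right | den_eq_left | den_eq_right | den_mem_left | den_mem_right =>
    exact .den_toHAHP _ _ _

/-- HAHP is conservative over each of the languages without application. -/
theorem provable_toHAHP_iff [NoApp L] (A : Fml L) : Provable A.toHAHP ↔ Provable A := by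
  refine ⟨fun d => ?_, fun d => Der.toHAHP d⟩
  have := Om.sem_of_der d Sub.vars ([] : List (Fml L)) (by simp)
  rw [Om.sem_toHAHP, Fml.subst_vars] at this
  exact this

end HOArith

theorem mainTheorem6 :
    (∀ A : HOArith.Fml .hah, HOArith.Provable A.toHAHP ↔ HOArith.Provable A) ∧
    (∀ A : HOArith.Fml .hahPartial, HOArith.Provable A.toHAHP ↔ HOArith.Provable A) :=
  ⟨HOArith.provable_toHAHP_iff, HOArith.provable_toHAHP_iff⟩
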